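/- Let $X, Y$ be Banach spaces over $\mathbb K\in\{\mathbb R,\mathbb C\}$, let $p\in[1,\infty]$ and let $p'$ be the conjugate exponent, $1/p+1/p'=1$. For a finite family $(y_i)$ in a Banach space $F$ put $w_p(y_i)=\sup_{f\in F^*,\ \|f\|\le 1}\|(f(y_i))_i\|_{\ell_p}$. Let $\Pi_p(Y,X)$ be the space of absolutely $p$-summing operators $U:Y\to X$, i.e. bounded operators for which there is $C\ge 0$ with $\|(\|Uy_i\|)_i\|_{\ell_p}\le C\,w_p(y_i)$ for all finite families $(y_i)$ in $Y$ (so $\Pi_\infty$ consists of all bounded operators), and let $\pi_p(U)$ be the least such $C$. For a nonempty compact absolutely convex set $K\subset Y$ let $Y_K$ be the linear span of $K$, normed by the gauge of $K$, and $\Phi_K:Y_K\to Y$ the inclusion. Let $\tau_p$ be the vector space topology on $\Pi_p(Y,X)$ a local base of which at zero is formed by the sets $\{U\in\Pi_p(Y,X):\pi_p(U\Phi_K)<\varepsilon\}$, with $K$ as above and $\varepsilon>0$. Let $X^*\widehat\otimes_{p'}Y$ be the completion of $X^*\otimes Y$ in the norm $$\|z\|_{p'}=\inf\Big\{\|(\|x_i'\|)_i\|_{\ell_{p'}}\;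 w_p(y_i)\;:\; z=\sum_{i=1}^n x_i'\otimes y_i\Big\}.$$ For $z\in X^*\widehat\otimes_{p'}Y$ and $U\in\Pi_p(Y,X)$ let $U\circ z\in X^*\widehat\otimes X$ (the projective tensor product) be the image of $z$ under the continuous extension of $x'\otimes y\mapsto x'\otimes Uy$, and let $\operatorname{trace}$ be the continuous extension of $x'\otimes x\mapsto x'(x)$ to $X^*\widehat\otimes X$. **Proposition 1.** Let $R$ be a linear subspace of $\Pi_p(Y,X)$ that contains $Y^*\otimes X$ (all finite rank operators), with the topology induced by $\tau_p$. (a) For every continuous linear functional $\varphi$ on $(R,\tau_p)$ there is an element $z=\sum_{n=1}^\infty x_n'\otimes y_n\in X^*\widehat\otimes_{p'}Y$, where $(x_n')$ belongs to $\ell_{p'}(X^*)$ (to $c_0(X^*)$ if $p'=\infty$), $(f(y_n))_n\in\ell_p$ for every $f\in Y^*$, and the series converges unconditionally, such that $$\varphi(U)=\operatorname{trace}(U\circ z)\qquad\text{for all } U\in R. \tag{$*$}$$ (b) Conversely, for every $z\in X^*\widehat\otimes_{p'}Y$ the relation $(*)$ defines a continuous linear functional on $(R,\tau_p)$. (c)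 Consequently, $(R,\tau_p)'$ is linearly isomorphic to a factor space of $X^*\widehat\otimes_{p'}Y$: there are a closed linear subspace $N$ of $X^*\widehat\otimes_{p'}Y$ and a linear bijection of $(X^*\widehat\otimes_{p'}Y)/N$ onto $(R,\tau_p)'$ that takes the class of each $z$ to the functional $U\mapsto\operatorname{trace}(U\circ z)$. -/

import Mathlib

open scoped ENNReal TensorProduct Topology
open WithLp

noncomputable section

namespace PSumming

/-! ### `ℓ_p` norms and weak `ℓ_p` norms of finite families -/

section Norms

/-- The (strong) `ℓ_p` norm of a finite family of vectors: `(∑ ‖x i‖ ^ p) ^ (1 / p)`, and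
`max ‖x i‖` for `p = ∞`. -/
def lpNorm (p : ℝ≥0∞) {E : Type*} [NormedAddCommGroup E] {n : ℕ} (x : Fin n → E) : ℝ :=
  ‖(toLp p x : PiLp p fun _ : Fin n => E)‖

/-- The weak `ℓ_p` norm of a finite family: the supremum of `‖(f (y i))_i‖_p` over the
functionals `f` in the closed unit ball of the dual space. -/
def weakNorm (𝕜 : Type*) [RCLike 𝕜] (p : ℝ≥0∞) {F : Type*} [NormedAddCommGroup F]
    [NormedSpace 𝕜 F] {n : ℕ} (y : Fin n → F) : ℝ :=
  ⨆ f : Metric.closedBall (0 : StrongDual 𝕜 F) 1, lpNorm p fun i => f.1 (y i)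

variable {p : ℝ≥0∞} {E F : Type*} [NormedAddCommGroup E] [NormedAddCommGroup F] {n m : ℕ}

theorem lpNorm_top (x : Fin n → E) : lpNorm ∞ x = ⨆ i, ‖x i‖ := PiLp.norm_eq_ciSup _

theorem lpNorm_eq_sum (hp : 0 < p.toReal) (x : Fin n → E) :
    lpNorm p x = (∑ i, ‖x i‖ ^ p.toReal) ^ (1 / p.toReal) := PiLp.norm_eq_sum hp _

theorem toReal_pos_of_ne_top [h : Fact (1 ≤ p)] (hp : p ≠ ∞) : 0 < p.toReal :=
  ENNReal.toReal_pos (zero_lt_one.trans_le h.out).ne' hp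

theorem lpNorm_nonneg [Fact (1 ≤ p)] (x : Fin n → E) : 0 ≤ lpNorm p x := norm_nonneg _

theorem lpNorm_add_le [Fact (1 ≤ p)] (x y : Fin n → E) :
    lpNorm p (fun i => x i + y i) ≤ lpNorm p x + lpNorm p y :=
  norm_add_le (toLp p x : PiLp p fun _ : Fin n => E) (toLp p y)

theorem lpNorm_mono [Fact (1 ≤ p)] {x : Fin n → E} {y : Fin n → F} (h : ∀ i, ‖x i‖ ≤ ‖y i‖) :
    lpNorm p x ≤ lpNorm p y := by
  rcases eq_or_ne p ∞ with rfl | hp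
  · rw [lpNorm_top, lpNorm_top]
    exact ciSup_mono (Set.finite_range _).bddAbove h
  · have := toReal_pos_of_ne_top hp
    rw [lpNorm_eq_sum this, lpNorm_eq_sum this]
    gcongr with i
    exact h i

theorem lpNorm_le_mul [Fact (1 ≤ p)] {x : Fin n → E} {y : Fin n → F} {C : ℝ} (hC : 0 ≤ C)
    (h : ∀ i, ‖x i‖ ≤ C * ‖y i‖) : lpNorm p x ≤ C * lpNorm p y := by
  calc lpNorm p x ≤ lpNorm p (fun i => C * ‖y i‖) := lpNorm_mono fun i => by
        rw [Real.norm_of_nonneg (by positivity)]; exact h i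
    _ = C * lpNorm p (fun i => ‖y i‖) := by
        have := norm_smul C (toLp p (fun i => ‖y i‖) : PiLp p fun _ : Fin n => ℝ)
        rw [Real.norm_of_nonneg hC] at this
        exact this
    _ ≤ C * lpNorm p y := by
        gcongr
        exact lpNorm_mono fun i => by simp

theorem lpNorm_append [Fact (1 ≤ p)] {x : Fin n → E} {y : Fin m → E} {a b : ℝ} (ha : 0 < a)
    (hb : 0 < b) (hx : lpNorm p x ≤ a ^ (p⁻¹).toReal) (hy : lpNorm p y ≤ b ^ (p⁻¹).toReal) :
    lpNorm p (Fin.append x y) ≤ (a + b) ^ (p⁻¹).toReal := by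
  rcases eq_or_ne p ∞ with rfl | hp
  · simp only [ENNReal.inv_top, ENNReal.toReal_zero, Real.rpow_zero, lpNorm_top] at *
    refine Real.iSup_le (fun i => ?_) zero_le_one
    induction i using Fin.addCases with
    | left i =>
      rw [Fin.append_left]
      exact (le_ciSup (f := fun i => ‖x i‖) (Set.finite_range _).bddAbove i).trans hx
    | right i =>
      rw [Fin.append_right]
      exact (le_ciSup (f := fun i => ‖y i‖) (Set.finite_range _).bddAbove i).trans hy
  · have hpos := toReal_pos_of_ne_top hp
    rw [ENNReal.toReal_inv] at *
    rw [lpNorm_eq_sum hpos, one_div] at *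
    rw [Real.rpow_le_rpow_iff (by positivity) (by positivity) (by positivity)] at *
    rw [Fin.sum_univ_add]
    simp only [Fin.append_left, Fin.append_right]
    exact add_le_add hx hy

theorem holder_sum {q r : ℝ≥0∞} [hqr : q.HolderConjugate r] (x : Fin n → E) (y : Fin n → F) :
    ∑ i, ‖x i‖ * ‖y i‖ ≤ lpNorm q x * lpNorm r y := by
  rcases eq_or_ne q ∞ with rfl | hq
  · obtain rfl : r = 1 := ENNReal.HolderConjugate.unique ∞ r 1
    rw [lpNorm_top, lpNorm_eq_sum (by simp)]
    simp only [ENNReal.toReal_one, Real.rpow_one, div_one, Finset.mul_sum]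
    gcongr with i
    exact le_ciSup (f := fun i => ‖x i‖) (Set.finite_range _).bddAbove i
  rcases eq_or_ne r ∞ with rfl | hr
  · obtain rfl : q = 1 := ENNReal.HolderConjugate.unique ∞ q 1
    rw [lpNorm_top, lpNorm_eq_sum (by simp)]
    simp only [ENNReal.toReal_one, Real.rpow_one, div_one, Finset.sum_mul]
    gcongr with i
    exact le_ciSup (f := fun i => ‖y i‖) (Set.finite_range _).bddAbove i
  have h := ENNReal.HolderConjugate.toReal_of_ne_top (p := q) (q := r) hq hr
  rw [lpNorm_eq_sum h.pos, lpNorm_eq_sum h.symm.pos]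
  simpa using Real.inner_le_Lp_mul_Lq Finset.univ (fun i => ‖x i‖) (fun i => ‖y i‖) h

variable {𝕜 : Type*} [RCLike 𝕜] [NormedSpace 𝕜 E] [NormedSpace 𝕜 F]

theorem lpNorm_apply_le [Fact (1 ≤ p)] (f : StrongDual 𝕜 F) (y : Fin n → F) :
    lpNorm p (fun i => f (y i)) ≤ ‖f‖ * lpNorm p y :=
  lpNorm_le_mul (norm_nonneg _) fun i => f.le_opNorm _

theorem le_weakNorm [Fact (1 ≤ p)] (f : StrongDual 𝕜 F) (hf : ‖f‖ ≤ 1) (y : Fin n → F) :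
    lpNorm p (fun i => f (y i)) ≤ weakNorm 𝕜 p y := by
  refine le_ciSup (f := fun f : Metric.closedBall (0 : StrongDual 𝕜 F) 1 =>
    lpNorm p fun i => f.1 (y i)) ⟨lpNorm p y, ?_⟩ ⟨f, by simpa using hf⟩
  rintro _ ⟨g, rfl⟩
  have hg : ‖g.1‖ ≤ 1 := mem_closedBall_zero_iff.1 g.2
  exact (lpNorm_apply_le g.1 y).trans (mul_le_of_le_one_left (lpNorm_nonneg _) hg)

theorem weakNorm_nonneg [Fact (1 ≤ p)] (y : Fin n → F) : 0 ≤ weakNorm 𝕜 p y :=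
  (lpNorm_nonneg _).trans (le_weakNorm (0 : StrongDual 𝕜 F) (by simp) y)

theorem weakNorm_le {y : Fin n → F} {C : ℝ}
    (h : ∀ f : StrongDual 𝕜 F, ‖f‖ ≤ 1 → lpNorm p (fun i => f (y i)) ≤ C) :
    weakNorm 𝕜 p y ≤ C := by
  have : Nonempty (Metric.closedBall (0 : StrongDual 𝕜 F) 1) := ⟨⟨0, by simp⟩⟩
  exact ciSup_le fun f => h f.1 (mem_closedBall_zero_iff.1 f.2)

theorem lpNorm_apply_le_weakNorm [Fact (1 ≤ p)] (f : StrongDual 𝕜 F) (y : Fin n → F) :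
    lpNorm p (fun i => f (y i)) ≤ ‖f‖ * weakNorm 𝕜 p y := by
  rcases eq_or_ne ‖f‖ 0 with h | h
  · have := lpNorm_apply_le (p := p) f y
    rw [h, zero_mul] at *
    exact this
  have h0 : 0 < ‖f‖ := lt_of_le_of_ne (norm_nonneg _) h.symm
  have h1 : ‖(((‖f‖⁻¹ : ℝ) : 𝕜) • f)‖ ≤ 1 := by
    rw [norm_smul, RCLike.norm_ofReal, abs_of_pos (by positivity), inv_mul_cancel₀ h]
  calc lpNorm p (fun i => f (y i))
      ≤ ‖f‖ * lpNorm p (fun i => (((‖f‖⁻¹ : ℝ) : 𝕜) • f) (y i)) :=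
        lpNorm_le_mul h0.le fun i => by
          rw [_root_.smul_apply, norm_smul, RCLike.norm_ofReal,
            abs_of_pos (by positivity), mul_inv_cancel_left₀ h]
    _ ≤ ‖f‖ * weakNorm 𝕜 p y := by
        gcongr
        exact le_weakNorm _ h1 y

theorem weakNorm_map_le [Fact (1 ≤ p)] (T : E →L[𝕜] F) (y : Fin n → E) :
    weakNorm 𝕜 p (fun i => T (y i)) ≤ ‖T‖ * weakNorm 𝕜 p y := by
  refine weakNorm_le fun f hf => (lpNorm_apply_le_weakNorm (f.comp T) y).trans ?_
  gcongr
  · exact weakNorm_nonneg y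
  · exact (f.opNorm_comp_le T).trans (mul_le_of_le_one_left (norm_nonneg _) hf)

theorem weakNorm_append [Fact (1 ≤ p)] {x : Fin n → F} {y : Fin m → F} {a b : ℝ} (ha : 0 < a)
    (hb : 0 < b) (hx : weakNorm 𝕜 p x ≤ a ^ (p⁻¹).toReal)
    (hy : weakNorm 𝕜 p y ≤ b ^ (p⁻¹).toReal) :
    weakNorm 𝕜 p (Fin.append x y) ≤ (a + b) ^ (p⁻¹).toReal := by
  refine weakNorm_le fun f hf => ?_
  have := lpNorm_append (p := p) ha hb ((le_weakNorm f hf x).trans hx)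
    ((le_weakNorm f hf y).trans hy)
  convert this using 2
  ext i
  induction i using Fin.addCases <;> simp

end Norms

/-! ### Absolutely `p`-summing operators -/

section Summing

variable (𝕜 : Type*) [RCLike 𝕜] (p : ℝ≥0∞)
  (Y X : Type*) [NormedAddCommGroup Y] [NormedSpace 𝕜 Y] [NormedAddCommGroup X] [NormedSpace 𝕜 X]

variable {𝕜 Y X} in
/-- `C` is a constant in the defining inequality of absolutely `p`-summing operators: for every
finite family, `‖(U y_i)‖_{ℓ_p} ≤ C * ‖(y_i)‖_{weak ℓ_p}`. -/
def IsSummingBound (U : Y →L[𝕜] X) (C : ℝ) : Prop :=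
  0 ≤ C ∧ ∀ (n : ℕ) (y : Fin n → Y), lpNorm p (fun i => U (y i)) ≤ C * weakNorm 𝕜 p y

variable {𝕜 p Y X} in
theorem IsSummingBound.add [Fact (1 ≤ p)] {U V : Y →L[𝕜] X} {C D : ℝ} (hU : IsSummingBound p U C)
    (hV : IsSummingBound p V D) : IsSummingBound p (U + V) (C + D) :=
  ⟨add_nonneg hU.1 hV.1, fun n y => by
    rw [add_mul]
    exact (lpNorm_add_le (fun i => U (y i)) fun i => V (y i)).trans
      (add_le_add (hU.2 n y) (hV.2 n y))⟩

variable {𝕜 p Y X} in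
theorem IsSummingBound.smul [Fact (1 ≤ p)] {U : Y →L[𝕜] X} {C : ℝ} (hU : IsSummingBound p U C)
    (c : 𝕜) : IsSummingBound p (c • U) (‖c‖ * C) :=
  ⟨mul_nonneg (norm_nonneg _) hU.1, fun n y => by
    rw [mul_assoc]
    refine (lpNorm_le_mul (norm_nonneg c) fun i => ?_).trans
      (mul_le_mul_of_nonneg_left (hU.2 n y) (norm_nonneg c))
    simp [norm_smul]⟩

variable [Fact (1 ≤ p)]

/-- The space `Π_p(Y, X)` of absolutely `p`-summing operators, as a linear subspace of the space
of bounded operators. (For `p = ∞` these are all bounded operators.) -/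
def summingSubmodule : Submodule 𝕜 (Y →L[𝕜] X) where
  carrier := {U | ∃ C, IsSummingBound p U C}
  zero_mem' := ⟨0, le_rfl, fun n y => by
    have := lpNorm_le_mul (p := p) (x := fun i => (0 : Y →L[𝕜] X) (y i)) (y := y) le_rfl
      (fun i => by simp)
    simpa using this⟩
  add_mem' := by
    rintro U V ⟨C, hC⟩ ⟨D, hD⟩
    exact ⟨C + D, hC.add hD⟩
  smul_mem' := by
    rintro c U ⟨C, hC⟩
    exact ⟨‖c‖ * C, hC.smul c⟩

/-- The vector space `Π_p(Y, X)`, as a type of its own, since it is going to carry the topology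
`τ_p` and not the topology of the operator norm. -/
def SummingOp : Type _ := ↥(summingSubmodule 𝕜 p Y X)

instance : AddCommGroup (SummingOp 𝕜 p Y X) :=
  inferInstanceAs (AddCommGroup ↥(summingSubmodule 𝕜 p Y X))

instance : Module 𝕜 (SummingOp 𝕜 p Y X) :=
  inferInstanceAs (Module 𝕜 ↥(summingSubmodule 𝕜 p Y X))

variable {𝕜 p Y X}

namespace SummingOp

/-- The bounded operator underlying an absolutely `p`-summing operator. -/
def toCLM : SummingOp 𝕜 p Y X →ₗ[𝕜] (Y →L[𝕜] X) := (summingSubmodule 𝕜 p Y X).subtype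

/-- The absolutely `p`-summing norm `π_p(U)`: the least constant `C` in the defining
inequality. -/
def piNorm (U : SummingOp 𝕜 p Y X) : ℝ := sInf {C | IsSummingBound p U.toCLM C}

theorem bddBelow (U : SummingOp 𝕜 p Y X) : BddBelow {C | IsSummingBound p U.toCLM C} :=
  ⟨0, fun _ h => h.1⟩

theorem nonempty (U : SummingOp 𝕜 p Y X) : {C | IsSummingBound p U.toCLM C}.Nonempty := U.2

theorem piNorm_nonneg (U : SummingOp 𝕜 p Y X) : 0 ≤ U.piNorm :=
  Real.sInf_nonneg fun _ h => h.1

theorem piNorm_le (U : SummingOp 𝕜 p Y X) {C : ℝ} (h : IsSummingBound p U.toCLM C) :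
    U.piNorm ≤ C := csInf_le U.bddBelow h

theorem isSummingBound_piNorm (U : SummingOp 𝕜 p Y X) : IsSummingBound p U.toCLM U.piNorm := by
  refine ⟨U.piNorm_nonneg, fun n y => ?_⟩
  rcases (weakNorm_nonneg (𝕜 := 𝕜) (p := p) y).eq_or_lt with h | h
  · obtain ⟨C, hC⟩ := U.nonempty
    simpa [← h] using hC.2 n y
  · rw [← div_le_iff₀ h]
    exact le_csInf U.nonempty fun C hC => (div_le_iff₀ h).2 (hC.2 n y)

/-- `π_p` as a seminorm on `Π_p(Y, X)` (it is in fact a norm). -/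
def piSeminorm : Seminorm 𝕜 (SummingOp 𝕜 p Y X) :=
  Seminorm.ofSMulLE piNorm
    (le_antisymm (piNorm_le _ (by
      have := (0 : SummingOp 𝕜 p Y X).isSummingBound_piNorm.smul (0 : 𝕜)
      simpa using this)) (piNorm_nonneg _))
    (fun U V => piNorm_le _ (by
      rw [map_add]
      exact U.isSummingBound_piNorm.add V.isSummingBound_piNorm))
    (fun c U => piNorm_le _ (by
      rw [map_smul]
      exact U.isSummingBound_piNorm.smul c))

/-- The rank one operator `f ⊗ x : y ↦ f(y) x`. These operators span `Y* ⊗ X`. -/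
def rankOne (f : StrongDual 𝕜 Y) (x : X) : SummingOp 𝕜 p Y X :=
  ⟨f.smulRight x, ‖x‖ * ‖f‖, by positivity, fun n y => by
    rw [mul_assoc]
    refine (lpNorm_le_mul (norm_nonneg x) fun i => ?_).trans
      (mul_le_mul_of_nonneg_left (lpNorm_apply_le_weakNorm f y) (norm_nonneg x))
    simp [norm_smul, mul_comm]⟩

/-- Composition `U ↦ U Φ` of absolutely `p`-summing operators with a bounded operator. -/
def precomp {Z : Type*} [NormedAddCommGroup Z] [NormedSpace 𝕜 Z] (Φ : Z →L[𝕜] Y) :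
    SummingOp 𝕜 p Y X →ₗ[𝕜] SummingOp 𝕜 p Z X where
  toFun U := ⟨U.toCLM.comp Φ, U.piNorm * ‖Φ‖, mul_nonneg U.piNorm_nonneg (norm_nonneg _),
    fun n y => by
      rw [mul_assoc]
      exact (U.isSummingBound_piNorm.2 n fun i => Φ (y i)).trans
        (mul_le_mul_of_nonneg_left (weakNorm_map_le Φ y) U.piNorm_nonneg)⟩
  map_add' _ _ := rfl
  map_smul' _ _ := rfl

end SummingOp

end Summing

/-! ### The Banach space spanned by an absolutely convex compact set -/

section Disc

variable (𝕜 : Type*) [RCLike 𝕜] (Y : Type*) [NormedAddCommGroup Y] [NormedSpace 𝕜 Y]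

/-- A nonempty compact absolutely convex subset `K` of `Y`. As a compact set is closed, these are
the compact sets that coincide with their closed absolutely convex hulls. -/
structure CompactDisc where
  /-- The underlying set. -/
  carrier : Set Y
  isCompact : IsCompact carrier
  nonempty : carrier.Nonempty
  absConvex : ∀ x ∈ carrier, ∀ y ∈ carrier, ∀ a b : 𝕜, ‖a‖ + ‖b‖ ≤ 1 → a • x + b • y ∈ carrier

instance : Nonempty (CompactDisc 𝕜 Y) :=
  ⟨⟨{0}, isCompact_singleton, ⟨0, rfl⟩, by simp⟩⟩

variable {𝕜 Y}

namespace CompactDisc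

variable (K : CompactDisc 𝕜 Y)

/-- `Y_K`: the linear span of `K`, to be normed by the gauge of `K`. -/
def Space : Type _ := ↥(Submodule.span 𝕜 K.carrier)

instance : AddCommGroup K.Space := inferInstanceAs (AddCommGroup ↥(Submodule.span 𝕜 K.carrier))

instance : Module 𝕜 K.Space := inferInstanceAs (Module 𝕜 ↥(Submodule.span 𝕜 K.carrier))

/-- The inclusion of `Y_K` into `Y`, as a linear map. -/
def incl : K.Space →ₗ[𝕜] Y := (Submodule.span 𝕜 K.carrier).subtype

/-- The numbers `r ≥ 0` with `x ∈ r K`. -/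
def dilations (x : Y) : Set ℝ := {r | 0 ≤ r ∧ ∃ k ∈ K.carrier, x = (r : 𝕜) • k}

/-- The norm of `Y_K` is the gauge of `K`: the infimum of all `r ≥ 0` with `x ∈ r K`. -/
instance : Norm K.Space := ⟨fun x => sInf (K.dilations (K.incl x))⟩

theorem norm_def (x : K.Space) : ‖x‖ = sInf (K.dilations (K.incl x)) := rfl

variable {K}

theorem dilations_zero : (0 : ℝ) ∈ K.dilations 0 := by
  obtain ⟨k, hk⟩ := K.nonempty
  exact ⟨le_rfl, k, hk, by simp⟩

theorem dilations_add {x y : Y} {r s : ℝ} (hr : r ∈ K.dilations x) (hs : s ∈ K.dilations y) :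
    r + s ∈ K.dilations (x + y) := by
  obtain ⟨hr0, k, hk, rfl⟩ := hr
  obtain ⟨hs0, l, hl, rfl⟩ := hs
  refine ⟨add_nonneg hr0 hs0, ?_⟩
  rcases (add_nonneg hr0 hs0).eq_or_lt with h | h
  · obtain rfl : r = 0 := by linarith
    obtain rfl : s = 0 := by linarith
    exact ⟨k, hk, by simp⟩
  · refine ⟨((r / (r + s) : ℝ) : 𝕜) • k + ((s / (r + s) : ℝ) : 𝕜) • l,
      K.absConvex k hk l hl _ _ ?_, ?_⟩
    · rw [RCLike.norm_ofReal, RCLike.norm_ofReal, abs_of_nonneg (by positivity),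
        abs_of_nonneg (by positivity), ← add_div, div_self h.ne']
    · rw [smul_add, smul_smul, smul_smul, ← RCLike.ofReal_mul, ← RCLike.ofReal_mul,
        mul_div_cancel₀ _ h.ne', mul_div_cancel₀ _ h.ne']

theorem dilations_smul {x : Y} {r : ℝ} (c : 𝕜) (hr : r ∈ K.dilations x) :
    ‖c‖ * r ∈ K.dilations (c • x) := by
  obtain ⟨hr0, k, hk, rfl⟩ := hr
  refine ⟨by positivity, ?_⟩
  rcases eq_or_ne c 0 with rfl | hc
  · exact ⟨k, hk, by simp⟩
  · have hc' : (‖c‖ : 𝕜) ≠ 0 := by simpa using hc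
    refine ⟨(c / (‖c‖ : 𝕜)) • k, ?_, ?_⟩
    · have := K.absConvex k hk k hk (c / (‖c‖ : 𝕜)) 0
        (by simp [div_self (norm_ne_zero_iff.2 hc)])
      simpa using this
    · rw [smul_smul, smul_smul, RCLike.ofReal_mul]
      congr 1
      field_simp

theorem dilations_nonempty (x : K.Space) : (K.dilations (K.incl x)).Nonempty := by
  obtain ⟨x, hx⟩ := x
  change (K.dilations x).Nonempty
  induction hx using Submodule.span_induction with
  | mem x hx => exact ⟨1, zero_le_one, x, hx, by simp⟩
  | zero => exact ⟨0, dilations_zero⟩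
  | add x y _ _ hx hy => exact ⟨_, dilations_add hx.some_mem hy.some_mem⟩
  | smul c x _ hx => exact ⟨_, dilations_smul c hx.some_mem⟩

theorem dilations_bddBelow (x : Y) : BddBelow (K.dilations x) := ⟨0, fun _ h => h.1⟩

theorem norm_le_of_mem {x : K.Space} {r : ℝ} (h : r ∈ K.dilations (K.incl x)) : ‖x‖ ≤ r :=
  csInf_le (dilations_bddBelow _) h

variable (K)

/-- The gauge of `K` as a seminorm on `Y_K`. -/
def gaugeSeminorm : Seminorm 𝕜 K.Space :=
  Seminorm.ofSMulLE (fun x => ‖x‖)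
    (le_antisymm (norm_le_of_mem (by simpa using dilations_zero))
      (Real.sInf_nonneg fun _ h => h.1))
    (fun x y => by
      refine le_of_forall_pos_le_add fun ε hε => ?_
      obtain ⟨r, hr, hr'⟩ := exists_lt_of_csInf_lt (dilations_nonempty x)
        (lt_add_of_pos_right (‖x‖) (half_pos hε))
      obtain ⟨s, hs, hs'⟩ := exists_lt_of_csInf_lt (dilations_nonempty y)
        (lt_add_of_pos_right (‖y‖) (half_pos hε))
      have : ‖x + y‖ ≤ r + s := norm_le_of_mem (by rw [map_add]; exact dilations_add hr hs)
      linarith)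
    (fun c x => by
      rcases eq_or_ne c 0 with rfl | hc
      · rw [norm_zero, zero_mul]
        exact norm_le_of_mem (by simpa using dilations_zero)
      have hc' : 0 < ‖c‖ := norm_pos_iff.2 hc
      rw [← div_le_iff₀' hc']
      refine le_csInf (dilations_nonempty x) fun r hr => ?_
      rw [div_le_iff₀' hc']
      exact norm_le_of_mem (by rw [map_smul]; exact dilations_smul c hr))

theorem exists_incl_le : ∃ C : ℝ, ∀ x : K.Space, ‖K.incl x‖ ≤ C * ‖x‖ := by
  obtain ⟨C, hC, hK⟩ := K.isCompact.isBounded.exists_pos_norm_le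
  refine ⟨C, fun x => ?_⟩
  rw [← div_le_iff₀' hC]
  refine le_csInf (dilations_nonempty x) ?_
  rintro r ⟨hr, k, hk, h⟩
  rw [div_le_iff₀' hC, h, norm_smul, RCLike.norm_ofReal, abs_of_nonneg hr, mul_comm]
  exact mul_le_mul_of_nonneg_right (hK k hk) hr

theorem core : NormedSpace.Core 𝕜 K.Space where
  norm_nonneg x := apply_nonneg K.gaugeSeminorm x
  norm_smul c x := map_smul_eq_mul K.gaugeSeminorm c x
  norm_triangle x y := map_add_le_add K.gaugeSeminorm x y
  norm_eq_zero_iff x := by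
    refine ⟨fun h => ?_, ?_⟩
    · obtain ⟨C, hC⟩ := K.exists_incl_le
      have := hC x
      rw [h, mul_zero, norm_le_zero_iff] at this
      exact Subtype.ext this
    · rintro rfl
      exact map_zero K.gaugeSeminorm

instance : NormedAddCommGroup K.Space := NormedAddCommGroup.ofCore K.core

instance : NormedSpace 𝕜 K.Space := NormedSpace.ofCore K.core

/-- The canonical embedding `Φ_K : Y_K → Y`. -/
def Phi : K.Space →L[𝕜] Y :=
  ⟨K.incl, by
    obtain ⟨C, hC⟩ := K.exists_incl_le
    exact AddMonoidHomClass.continuous_of_bound K.incl C hC⟩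

/-- The Minkowski sum of two compact absolutely convex sets. -/
def sum (K L : CompactDisc 𝕜 Y) : CompactDisc 𝕜 Y where
  carrier := (fun v : Y × Y => v.1 + v.2) '' (K.carrier ×ˢ L.carrier)
  isCompact := (K.isCompact.prod L.isCompact).image (continuous_fst.add continuous_snd)
  nonempty := (K.nonempty.prod L.nonempty).image _
  absConvex := by
    rintro _ ⟨⟨k, l⟩, ⟨hk, hl⟩, rfl⟩ _ ⟨⟨k', l'⟩, ⟨hk', hl'⟩, rfl⟩ a b hab
    refine ⟨(a • k + b • k', a • l + b • l'), ⟨K.absConvex k hk k' hk' a b hab,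
      L.absConvex l hl l' hl' a b hab⟩, ?_⟩
    simp only [smul_add]
    abel

theorem zero_mem : (0 : Y) ∈ K.carrier := by
  obtain ⟨k, hk⟩ := K.nonempty
  simpa using K.absConvex k hk k hk 0 0 (by simp)

theorem subset_sum_left (L : CompactDisc 𝕜 Y) : K.carrier ⊆ (K.sum L).carrier := fun k hk =>
  ⟨(k, 0), ⟨hk, L.zero_mem⟩, add_zero k⟩

theorem subset_sum_right (L : CompactDisc 𝕜 Y) : L.carrier ⊆ (K.sum L).carrier := fun l hl =>
  ⟨(0, l), ⟨K.zero_mem, hl⟩, zero_add l⟩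

variable {K} in
/-- The embedding `Y_K → Y_L` for `K ⊆ L`. -/
def inclusion {L : CompactDisc 𝕜 Y} (h : K.carrier ⊆ L.carrier) : K.Space →L[𝕜] L.Space :=
  LinearMap.mkContinuous
    (show K.Space →ₗ[𝕜] L.Space from Submodule.inclusion (Submodule.span_mono h)) 1 (fun x => by
      rw [one_mul]
      refine le_csInf (dilations_nonempty x) ?_
      rintro r ⟨hr, k, hk, hx⟩
      exact norm_le_of_mem ⟨hr, k, h hk, hx⟩)

variable {K} in
theorem norm_inclusion_le {L : CompactDisc 𝕜 Y} (h : K.carrier ⊆ L.carrier) :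
    ‖inclusion h‖ ≤ 1 := LinearMap.mkContinuous_norm_le _ zero_le_one _

end CompactDisc

end Disc

/-! ### The topology `τ_p` of `π_p`-compact convergence -/

section Tau

variable (𝕜 : Type*) [RCLike 𝕜] (p : ℝ≥0∞) [Fact (1 ≤ p)]
  (Y X : Type*) [NormedAddCommGroup Y] [NormedSpace 𝕜 Y] [NormedAddCommGroup X] [NormedSpace 𝕜 X]

/-- The seminorms `U ↦ π_p(U Φ_K)` on `Π_p(Y, X)`, indexed by the compact absolutely convex
subsets `K` of `Y`. -/
def tauSeminorms : SeminormFamily 𝕜 (SummingOp 𝕜 p Y X) (CompactDisc 𝕜 Y) := fun K =>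
  SummingOp.piSeminorm.comp (SummingOp.precomp K.Phi)

/-- The topology `τ_p` on `Π_p(Y, X)`: the locally convex topology defined by the seminorms
`U ↦ π_p(U Φ_K)`. Since `K + L` is again compact and absolutely convex, and contains `K` and `L`,
the sets `{U | π_p(U Φ_K) < ε}` form a local base at zero; see `hasBasis_tau`. -/
instance : TopologicalSpace (SummingOp 𝕜 p Y X) := (tauSeminorms 𝕜 p Y X).moduleFilterBasis.topology

variable {𝕜 p Y X}

theorem withSeminorms_tau : WithSeminorms (tauSeminorms 𝕜 p Y X) := ⟨rfl⟩

theorem tauSeminorms_mono {K L : CompactDisc 𝕜 Y} (h : K.carrier ⊆ L.carrier) :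
    tauSeminorms 𝕜 p Y X K ≤ tauSeminorms 𝕜 p Y X L := fun U => by
  have hb := (SummingOp.precomp L.Phi U).isSummingBound_piNorm
  refine SummingOp.piNorm_le _ ⟨SummingOp.piNorm_nonneg _, fun n y => ?_⟩
  refine (hb.2 n fun i => CompactDisc.inclusion h (y i)).trans
    (mul_le_mul_of_nonneg_left ?_ (SummingOp.piNorm_nonneg _))
  exact (weakNorm_map_le _ y).trans
    (mul_le_of_le_one_left (weakNorm_nonneg y) (CompactDisc.norm_inclusion_le h))

/-- The sets `ω_{K, ε} = {U | π_p(U Φ_K) < ε}` form a local base at zero of `τ_p`. -/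
theorem hasBasis_tau : (𝓝 (0 : SummingOp 𝕜 p Y X)).HasBasis
    (fun Kε : CompactDisc 𝕜 Y × ℝ => 0 < Kε.2)
    (fun Kε => {U | (SummingOp.precomp Kε.1.Phi U).piNorm < Kε.2}) := by
  have hsup (s : Finset (CompactDisc 𝕜 Y)) :
      ∃ K, s.sup (tauSeminorms 𝕜 p Y X) ≤ tauSeminorms 𝕜 p Y X K := by
    classical
    induction s using Finset.induction_on with
    | empty => exact ⟨Classical.arbitrary _, by simp⟩
    | insert L s _ ih =>
      obtain ⟨K, hK⟩ := ih
      refine ⟨L.sum K, ?_⟩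
      rw [Finset.sup_insert]
      exact sup_le (tauSeminorms_mono (L.subset_sum_left K))
        (hK.trans (tauSeminorms_mono (L.subset_sum_right K)))
  refine withSeminorms_tau.hasBasis_zero_ball.to_hasBasis ?_ ?_
  · rintro ⟨s, ε⟩ hε
    obtain ⟨K, hK⟩ := hsup s
    refine ⟨(K, ε), hε, fun U hU => ?_⟩
    rw [Seminorm.mem_ball_zero]
    exact (hK U).trans_lt hU
  · rintro ⟨K, ε⟩ hε
    refine ⟨({K}, ε), hε, fun U hU => ?_⟩
    rw [Seminorm.mem_ball_zero, Finset.sup_singleton] at hU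
    exact hU

end Tau

/-! ### The tensor products `E ⊗̂_q F` -/

section Tensor

variable (𝕜 : Type*) [RCLike 𝕜] (q r : ℝ≥0∞)
  (E F : Type*) [NormedAddCommGroup E] [NormedSpace 𝕜 E] [NormedAddCommGroup F] [NormedSpace 𝕜 F]

/-- The algebraic tensor product `E ⊗ F`, to be normed by the `q`-nuclear norm, where `r` is the
exponent conjugate to `q`. -/
@[nolint unusedArguments]
def NuclearTensor (𝕜 : Type*) [RCLike 𝕜] (_q _r : ℝ≥0∞) (E F : Type*) [NormedAddCommGroup E]
    [NormedSpace 𝕜 E] [NormedAddCommGroup F] [NormedSpace 𝕜 F] : Type _ := E ⊗[𝕜] F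

instance : AddCommGroup (NuclearTensor 𝕜 q r E F) := inferInstanceAs (AddCommGroup (E ⊗[𝕜] F))

instance : Module 𝕜 (NuclearTensor 𝕜 q r E F) := inferInstanceAs (Module 𝕜 (E ⊗[𝕜] F))

variable {𝕜 E F} in
/-- The elementary tensor `x ⊗ y`. -/
def tmul (x : E) (y : F) : NuclearTensor 𝕜 q r E F := x ⊗ₜ[𝕜] y

/-- The `q`-nuclear tensor norm: the infimum of `‖(x_i)‖_{ℓ_q} * ‖(y_i)‖_{weak ℓ_r}` over all
representations `z = ∑ i, x_i ⊗ y_i`. For `q = 1`, `r = ∞` this is the projective norm. -/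
instance : Norm (NuclearTensor 𝕜 q r E F) :=
  ⟨fun z => sInf {c | ∃ (n : ℕ) (x : Fin n → E) (y : Fin n → F),
    z = ∑ i, tmul q r (x i) (y i) ∧ c = lpNorm q x * weakNorm 𝕜 r y}⟩

variable {𝕜 q r E F}

theorem exists_rep (z : NuclearTensor 𝕜 q r E F) :
    ∃ (n : ℕ) (x : Fin n → E) (y : Fin n → F), z = ∑ i, tmul q r (x i) (y i) := by
  induction z using TensorProduct.induction_on with
  | zero => exact ⟨0, 0, 0, rfl⟩
  | tmul x y => exact ⟨1, fun _ => x, fun _ => y, by simp; rfl⟩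
  | add z w hz hw =>
    obtain ⟨n, x, y, hz⟩ := hz
    obtain ⟨m, x', y', hw⟩ := hw
    refine ⟨n + m, Fin.append x x', Fin.append y y', ?_⟩
    rw [Fin.sum_univ_add]
    simp only [Fin.append_left, Fin.append_right]
    rw [← hz, ← hw]
    rfl

theorem tmul_smul_smul (a b : 𝕜) (x : E) (y : F) :
    (tmul q r (a • x) (b • y) : NuclearTensor 𝕜 q r E F) = (a * b) • tmul q r x y :=
  TensorProduct.smul_tmul_smul a b x y

theorem exists_rep_lt {z : NuclearTensor 𝕜 q r E F} {a : ℝ} (h : ‖z‖ < a) :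
    ∃ (n : ℕ) (x : Fin n → E) (y : Fin n → F), z = ∑ i, tmul q r (x i) (y i) ∧
      lpNorm q x * weakNorm 𝕜 r y < a := by
  obtain ⟨n₀, x₀, y₀, hz₀⟩ := exists_rep z
  have hne : {c | ∃ (n : ℕ) (x : Fin n → E) (y : Fin n → F),
      z = ∑ i, tmul q r (x i) (y i) ∧ c = lpNorm q x * weakNorm 𝕜 r y}.Nonempty :=
    ⟨_, n₀, x₀, y₀, hz₀, rfl⟩
  obtain ⟨_, ⟨n, x, y, hz, rfl⟩, h⟩ := exists_lt_of_csInf_lt hne h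
  exact ⟨n, x, y, hz, h⟩

variable [hqr : q.HolderConjugate r]

theorem fact_left (q r : ℝ≥0∞) [q.HolderConjugate r] : Fact (1 ≤ q) :=
  ⟨ENNReal.HolderConjugate.one_le q r⟩

theorem fact_right (q r : ℝ≥0∞) [q.HolderConjugate r] : Fact (1 ≤ r) :=
  ⟨ENNReal.HolderConjugate.one_le r q⟩

theorem norm_le_of_rep {n : ℕ} (x : Fin n → E) (y : Fin n → F) :
    ‖∑ i, tmul (𝕜 := 𝕜) q r (x i) (y i)‖ ≤ lpNorm q x * weakNorm 𝕜 r y := by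
  have := fact_left q r
  have := fact_right q r
  refine csInf_le ⟨0, ?_⟩ ⟨n, x, y, rfl, rfl⟩
  rintro _ ⟨m, x', y', -, rfl⟩
  exact mul_nonneg (lpNorm_nonneg _) (weakNorm_nonneg _)

theorem nuclear_norm_nonneg (z : NuclearTensor 𝕜 q r E F) : 0 ≤ ‖z‖ := by
  have := fact_left q r
  have := fact_right q r
  refine Real.sInf_nonneg ?_
  rintro _ ⟨m, x', y', -, rfl⟩
  exact mul_nonneg (lpNorm_nonneg _) (weakNorm_nonneg _)

theorem rpow_mul_rpow {a : ℝ} (ha : 0 < a) : a ^ (q⁻¹).toReal * a ^ (r⁻¹).toReal = a := by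
  have hq : q⁻¹ ≠ ∞ := by
    simpa using (zero_lt_one.trans_le (fact_left q r).out).ne'
  have hr : r⁻¹ ≠ ∞ := by
    simpa using (zero_lt_one.trans_le (fact_right q r).out).ne'
  rw [← Real.rpow_add ha, ← ENNReal.toReal_add hq hr,
    ENNReal.HolderConjugate.inv_add_inv_eq_one q r, ENNReal.toReal_one, Real.rpow_one]

theorem exists_rep_balanced {z : NuclearTensor 𝕜 q r E F} {a : ℝ} (h : ‖z‖ < a) :
    ∃ (n : ℕ) (x : Fin n → E) (y : Fin n → F), z = ∑ i, tmul q r (x i) (y i) ∧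
      lpNorm q x ≤ a ^ (q⁻¹).toReal ∧ weakNorm 𝕜 r y ≤ a ^ (r⁻¹).toReal := by
  have := fact_left q r
  have := fact_right q r
  have ha : 0 < a := (nuclear_norm_nonneg z).trans_lt h
  obtain ⟨n, x, y, hz, hxy⟩ := exists_rep_lt h
  have hA : 0 < a ^ (q⁻¹).toReal := Real.rpow_pos_of_pos ha _
  have hB : 0 < a ^ (r⁻¹).toReal := Real.rpow_pos_of_pos ha _
  have hAB := rpow_mul_rpow (q := q) (r := r) ha
  have hx0 := lpNorm_nonneg (p := q) x
  have hy0 := weakNorm_nonneg (𝕜 := 𝕜) (p := r) y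
  obtain ⟨t, ht, h1, h2⟩ : ∃ t : ℝ, 0 < t ∧ t * lpNorm q x ≤ a ^ (q⁻¹).toReal ∧
      t⁻¹ * weakNorm 𝕜 r y ≤ a ^ (r⁻¹).toReal := by
    rcases hx0.eq_or_lt with h0 | h0
    · refine ⟨(weakNorm 𝕜 r y + 1) / a ^ (r⁻¹).toReal, by positivity, ?_, ?_⟩
      · rw [← h0, mul_zero]; exact hA.le
      · rw [inv_div, div_mul_eq_mul_div, div_le_iff₀ (by positivity)]
        nlinarith
    · refine ⟨a ^ (q⁻¹).toReal / lpNorm q x, by positivity, ?_, ?_⟩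
      · rw [div_mul_cancel₀ _ h0.ne']
      · rw [inv_div, div_mul_eq_mul_div, div_le_iff₀ hA, mul_comm (a ^ (r⁻¹).toReal), hAB]
        exact hxy.le
  have ht' : (t : 𝕜) ≠ 0 := by simpa using ht.ne'
  refine ⟨n, fun i => (t : 𝕜) • x i, fun i => ((t⁻¹ : ℝ) : 𝕜) • y i, ?_, ?_, ?_⟩
  · rw [hz]
    refine Finset.sum_congr rfl fun i _ => ?_
    rw [tmul_smul_smul, RCLike.ofReal_inv, mul_inv_cancel₀ ht', one_smul]
  · refine (lpNorm_le_mul ht.le fun i => ?_).trans h1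
    rw [norm_smul, RCLike.norm_ofReal, abs_of_pos ht]
  · refine (weakNorm_le fun f hf => ?_).trans h2
    refine (lpNorm_le_mul (inv_pos.2 ht).le fun i => ?_).trans
      (mul_le_mul_of_nonneg_left (le_weakNorm f hf y) (inv_pos.2 ht).le)
    rw [map_smul, norm_smul, RCLike.norm_ofReal, abs_of_pos (inv_pos.2 ht)]

/-- The `q`-nuclear norm on `E ⊗ F` as a seminorm. -/
def nuclearSeminorm : Seminorm 𝕜 (NuclearTensor 𝕜 q r E F) :=
  Seminorm.ofSMulLE (fun z => ‖z‖)
    (le_antisymm (by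
      have h0 := norm_le_of_rep (𝕜 := 𝕜) (q := q) (r := r) (0 : Fin 0 → E) (0 : Fin 0 → F)
      have := fact_left q r
      have h : lpNorm q (0 : Fin 0 → E) = 0 := by
        have h1 := lpNorm_le_mul (p := q) (x := (0 : Fin 0 → E)) (y := (0 : Fin 0 → E)) le_rfl
          (fun i => by simp)
        rw [zero_mul] at h1
        exact le_antisymm h1 (lpNorm_nonneg _)
      rw [h, zero_mul] at h0
      exact h0) (nuclear_norm_nonneg _))
    (fun z w => by
      have := fact_left q r
      have := fact_right q r
      refine le_of_forall_pos_le_add fun ε hε => ?_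
      have hz0 := nuclear_norm_nonneg z
      have hw0 := nuclear_norm_nonneg w
      have ha : 0 < ‖z‖ + ε / 2 := by positivity
      have hb : 0 < ‖w‖ + ε / 2 := by positivity
      obtain ⟨n, x, y, hz, hx, hy⟩ := exists_rep_balanced (lt_add_of_pos_right ‖z‖ (half_pos hε))
      obtain ⟨m, x', y', hw, hx', hy'⟩ :=
        exists_rep_balanced (lt_add_of_pos_right ‖w‖ (half_pos hε))
      have h := norm_le_of_rep (𝕜 := 𝕜) (q := q) (r := r) (Fin.append x x') (Fin.append y y')
      rw [Fin.sum_univ_add] at h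
      simp only [Fin.append_left, Fin.append_right] at h
      rw [← hz, ← hw] at h
      calc ‖z + w‖ ≤ _ := h
        _ ≤ (‖z‖ + ε / 2 + (‖w‖ + ε / 2)) ^ (q⁻¹).toReal *
            (‖z‖ + ε / 2 + (‖w‖ + ε / 2)) ^ (r⁻¹).toReal :=
          mul_le_mul (lpNorm_append ha hb hx hx') (weakNorm_append ha hb hy hy')
            (weakNorm_nonneg _) (by positivity)
        _ = ‖z‖ + ‖w‖ + ε := by rw [rpow_mul_rpow (add_pos ha hb)]; ring)
    (fun c z => by
      have := fact_left q r
      have := fact_right q r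
      refine le_of_forall_gt_imp_ge_of_dense fun b hb => ?_
      have hlt : ∃ a, ‖z‖ < a ∧ ‖c‖ * a ≤ b := by
        rcases (norm_nonneg c).eq_or_lt with h | h
        · exact ⟨‖z‖ + 1, by linarith, by rw [← h, zero_mul] at hb ⊢; exact hb.le⟩
        · exact ⟨b / ‖c‖, (lt_div_iff₀' h).2 hb, by rw [mul_div_cancel₀ _ h.ne']⟩
      obtain ⟨a, ha, hab⟩ := hlt
      obtain ⟨n, x, y, hz, hxy⟩ := exists_rep_lt ha
      have h := norm_le_of_rep (𝕜 := 𝕜) (q := q) (r := r) (fun i => c • x i) y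
      have hs : ∑ i, tmul (𝕜 := 𝕜) q r (c • x i) (y i) = c • z := by
        rw [hz, Finset.smul_sum]
        refine Finset.sum_congr rfl fun i _ => ?_
        simpa using tmul_smul_smul (q := q) (r := r) c 1 (x i) (y i)
      rw [hs] at h
      have h2 : lpNorm q (fun i => c • x i) ≤ ‖c‖ * lpNorm q x :=
        lpNorm_le_mul (norm_nonneg c) fun i => by rw [norm_smul]
      calc ‖c • z‖ ≤ _ := h
        _ ≤ ‖c‖ * lpNorm q x * weakNorm 𝕜 r y :=
          mul_le_mul_of_nonneg_right h2 (weakNorm_nonneg _)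
        _ = ‖c‖ * (lpNorm q x * weakNorm 𝕜 r y) := mul_assoc _ _ _
        _ ≤ ‖c‖ * a := mul_le_mul_of_nonneg_left hxy.le (norm_nonneg c)
        _ ≤ b := hab)

theorem nuclearCore : SeminormedSpace.Core 𝕜 (NuclearTensor 𝕜 q r E F) where
  norm_nonneg z := nuclear_norm_nonneg z
  norm_smul c z := map_smul_eq_mul (nuclearSeminorm (𝕜 := 𝕜) (q := q) (r := r)) c z
  norm_triangle z w := map_add_le_add (nuclearSeminorm (𝕜 := 𝕜) (q := q) (r := r)) z w

instance : SeminormedAddCommGroup (NuclearTensor 𝕜 q r E F) :=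
  SeminormedAddCommGroup.ofCore nuclearCore

instance : NormedSpace 𝕜 (NuclearTensor 𝕜 q r E F) := ⟨fun c z => (nuclearCore.norm_smul c z).le⟩

variable (𝕜 q r E F) in
/-- The Banach space `E ⊗̂_q F`: the completion of `E ⊗ F` in the `q`-nuclear norm. The exponent
`r` is the one conjugate to `q`. -/
abbrev CompletedTensor : Type _ := UniformSpace.Completion (NuclearTensor 𝕜 q r E F)

variable (𝕜 q r E F) in
/-- The canonical map of `E ⊗ F` into its completion. -/
abbrev toCompleted : NuclearTensor 𝕜 q r E F →L[𝕜] CompletedTensor 𝕜 q r E F :=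
  UniformSpace.Completion.toComplL

/-- `z = ∑_{n} x_n ⊗ y_n`, a representation of an element of `E ⊗̂_q F` by sequences: `(x_n)` is
in `ℓ_q(E)` (in `c_0(E)` for `q = ∞`), `(y_n)` is weakly `r`-summable (bounded for `r = ∞`), and
the series converges to `z` in `E ⊗̂_q F`. -/
structure IsRepresentation (z : CompletedTensor 𝕜 q r E F) (x : ℕ → E) (y : ℕ → F) : Prop where
  memℓp : Memℓp x q
  tendsto_zero : Filter.Tendsto x Filter.atTop (𝓝 0)
  weak_memℓp : ∀ f : StrongDual 𝕜 F, Memℓp (fun n => f (y n)) r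
  hasSum : HasSum (fun n => toCompleted 𝕜 q r E F (tmul q r (x n) (y n))) z

end Tensor

/-! ### Composition of tensors with summing operators, and the trace -/

section Trace

variable {𝕜 : Type*} [RCLike 𝕜] {q p : ℝ≥0∞} [hqp : q.HolderConjugate p] [Fact (1 ≤ p)]
  {E X Y : Type*} [NormedAddCommGroup E] [NormedSpace 𝕜 E]
  [NormedAddCommGroup X] [NormedSpace 𝕜 X] [NormedAddCommGroup Y] [NormedSpace 𝕜 Y]

theorem projective_norm_le {n : ℕ} (x : Fin n → E) (y : Fin n → X) :
    ‖∑ i, tmul (𝕜 := 𝕜) 1 ∞ (x i) (y i)‖ ≤ ∑ i, ‖x i‖ * ‖y i‖ := by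
  refine (norm_sum_le _ _).trans (Finset.sum_le_sum fun i _ => ?_)
  have h := norm_le_of_rep (𝕜 := 𝕜) (q := 1) (r := ∞) (fun _ : Fin 1 => x i) (fun _ => y i)
  rw [Fin.sum_univ_one] at h
  have h1 : lpNorm 1 (fun _ : Fin 1 => x i) = ‖x i‖ := by
    rw [lpNorm_eq_sum (by simp)]; simp
  have h2 : weakNorm 𝕜 ∞ (fun _ : Fin 1 => y i) ≤ ‖y i‖ := by
    refine weakNorm_le fun f hf => ?_
    rw [lpNorm_top, ciSup_const]
    exact f.le_of_opNorm_le_of_le hf le_rfl |>.trans (by simp)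
  rw [h1] at h
  exact h.trans (mul_le_mul_of_nonneg_left h2 (norm_nonneg _))

/-- `z ↦ U ∘ z` on algebraic tensors, `x ⊗ y ↦ x ⊗ U y`, as a bounded linear map from `E ⊗ Y`
with the `q`-nuclear norm (`q` conjugate to `p`) to `E ⊗ X` with the projective norm. -/
def mapTensor (U : SummingOp 𝕜 p Y X) :
    NuclearTensor 𝕜 q p E Y →L[𝕜] NuclearTensor 𝕜 1 ∞ E X :=
  LinearMap.mkContinuous
    (show NuclearTensor 𝕜 q p E Y →ₗ[𝕜] NuclearTensor 𝕜 1 ∞ E X from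
      TensorProduct.map (LinearMap.id : E →ₗ[𝕜] E) (U.toCLM : Y →ₗ[𝕜] X))
    U.piNorm (fun z => by
      have := fact_left q p
      refine le_of_forall_pos_le_add fun ε hε => ?_
      have hU := U.piNorm_nonneg
      obtain ⟨n, x, y, hz, hxy⟩ := exists_rep_lt (z := z) (a := ‖z‖ + ε / (U.piNorm + 1))
        (by have : 0 < ε / (U.piNorm + 1) := by positivity
            linarith)
      set T : NuclearTensor 𝕜 q p E Y →ₗ[𝕜] NuclearTensor 𝕜 1 ∞ E X :=
        TensorProduct.map (LinearMap.id : E →ₗ[𝕜] E) (U.toCLM : Y →ₗ[𝕜] X) with hT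
      have hTz : T z = ∑ i, tmul 1 ∞ (x i) (U.toCLM (y i)) := by
        rw [hz, map_sum]; rfl
      calc ‖T z‖ ≤ ∑ i, ‖x i‖ * ‖U.toCLM (y i)‖ := by
            rw [hTz]; exact projective_norm_le _ _
        _ ≤ lpNorm q x * lpNorm p (fun i => U.toCLM (y i)) := holder_sum _ _
        _ ≤ lpNorm q x * (U.piNorm * weakNorm 𝕜 p y) :=
            mul_le_mul_of_nonneg_left (U.isSummingBound_piNorm.2 n y) (lpNorm_nonneg _)
        _ = U.piNorm * (lpNorm q x * weakNorm 𝕜 p y) := by ring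
        _ ≤ U.piNorm * (‖z‖ + ε / (U.piNorm + 1)) := mul_le_mul_of_nonneg_left hxy.le hU
        _ ≤ U.piNorm * ‖z‖ + ε := by
            rw [mul_add]
            gcongr
            rw [mul_div_assoc', div_le_iff₀ (by positivity)]
            nlinarith)

/-- The tensor `U ∘ z ∈ E ⊗̂ X`, for `z ∈ E ⊗̂_q Y` and `U ∈ Π_p(Y, X)`, `p` and `q` conjugate;
here `E ⊗̂ X` is the projective tensor product. It is the continuous extension of
`x ⊗ y ↦ x ⊗ U y`. -/
def compTensor (U : SummingOp 𝕜 p Y X) :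
    CompletedTensor 𝕜 q p E Y →L[𝕜] CompletedTensor 𝕜 1 ∞ E X :=
  ((toCompleted 𝕜 1 ∞ E X).comp (mapTensor U)).extend (toCompleted 𝕜 q p E Y)

variable (𝕜 X) in
/-- The trace `∑ f_i ⊗ x_i ↦ ∑ f_i(x_i)` on `X* ⊗ X`, which is bounded in the projective norm. -/
def traceAlg : NuclearTensor 𝕜 1 ∞ (StrongDual 𝕜 X) X →L[𝕜] 𝕜 :=
  LinearMap.mkContinuous
    (show NuclearTensor 𝕜 1 ∞ (StrongDual 𝕜 X) X →ₗ[𝕜] 𝕜 from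
      TensorProduct.lift (ContinuousLinearMap.coeLM 𝕜))
    1 (fun z => by
      refine le_of_forall_pos_le_add fun ε hε => ?_
      obtain ⟨n, x, y, hz, hxy⟩ := exists_rep_lt (lt_add_of_pos_right ‖z‖ hε)
      set T : NuclearTensor 𝕜 1 ∞ (StrongDual 𝕜 X) X →ₗ[𝕜] 𝕜 :=
        TensorProduct.lift (ContinuousLinearMap.coeLM 𝕜) with hT
      have hTz : T z = ∑ i, x i (y i) := by
        rw [hz, map_sum]; rfl
      have hx : lpNorm 1 x = ∑ i, ‖x i‖ := by
        rw [lpNorm_eq_sum (by simp)]; simp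
      have hi (i : Fin n) : ‖x i (y i)‖ ≤ ‖x i‖ * weakNorm 𝕜 ∞ y := by
        refine le_trans ?_ (lpNorm_apply_le_weakNorm (x i) y)
        rw [lpNorm_top]
        exact le_ciSup (f := fun j => ‖x i (y j)‖) (Set.finite_range _).bddAbove i
      calc ‖T z‖ ≤ ∑ i, ‖x i (y i)‖ := by rw [hTz]; exact norm_sum_le _ _
        _ ≤ ∑ i, ‖x i‖ * weakNorm 𝕜 ∞ y := Finset.sum_le_sum fun i _ => hi i
        _ = lpNorm 1 x * weakNorm 𝕜 ∞ y := by rw [hx, Finset.sum_mul]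
        _ ≤ 1 * ‖z‖ + ε := by rw [one_mul]; exact hxy.le)

theorem compTensor_toCompleted (U : SummingOp 𝕜 p Y X) (x : E) (y : Y) :
    compTensor U (toCompleted 𝕜 q p E Y (tmul q p x y)) =
      toCompleted 𝕜 1 ∞ E X (tmul 1 ∞ x (U.toCLM y)) :=
  ContinuousLinearMap.extend_eq _ UniformSpace.Completion.denseRange_coe
    (UniformSpace.Completion.isUniformInducing_coe _) _

variable (𝕜 X) in
/-- The trace functional on the projective tensor product `X* ⊗̂ X`: the continuous extension of
`f ⊗ x ↦ f(x)`. -/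
def trace : CompletedTensor 𝕜 1 ∞ (StrongDual 𝕜 X) X →L[𝕜] 𝕜 :=
  (traceAlg 𝕜 X).extend (toCompleted 𝕜 1 ∞ (StrongDual 𝕜 X) X)

theorem trace_toCompleted (f : StrongDual 𝕜 X) (x : X) :
    trace 𝕜 X (toCompleted 𝕜 1 ∞ (StrongDual 𝕜 X) X (tmul 1 ∞ f x)) = f x :=
  ContinuousLinearMap.extend_eq _ UniformSpace.Completion.denseRange_coe
    (UniformSpace.Completion.isUniformInducing_coe _) _

end Trace

end PSumming

end

/-!
The dual of `(R, τ_p)` consists of the functionals `U ↦ trace (U ∘ z)`.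

**Tensors define continuous functionals.** A tensor `z` in the completion is a sum of finite tensors
`∑_i x_{k,i} ⊗ y_{k,i}` for which the `ℓ_q` norms of the first factors (`q` is the exponent conjugate
to `p`) and the weak `ℓ_p` norms of the second factors decay geometrically. The latter norm is the
norm of the operator `a ↦ ∑_i a_i y_{k,i}` on a finite dimensional `ℓ_q`, so that the sum of the
images of the unit balls under these operators is a compact absolutely convex set `K`
(`exists_compactDisc`), and the families `(y_{k,i})_i` are bounded by one in the weak `ℓ_p` norm of
`Y_K`. Hölder's inequality then bounds the functional by a multiple of `π_p(U Φ_K)`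
(`exists_bound_traceFunctional`).

**Continuous functionals come from tensors.** Let `|φ(U)| ≤ C π_p(U Φ_K)`. As `π_p(U Φ_K)` is the
norm of `z ↦ trace (U Φ_K ∘ z)` on `X* ⊗ Y_K`, separation in finite dimensional spaces shows that `φ`
is a pointwise limit of functionals given by a bounded net in `X* ⊗ Y_K`
(`exists_tensor_approx`). The number of terms of these tensors is not bounded, so that one cannot
pass to the limit at once. Compactness of `K` helps: a family `(y_i)` in the weak `ℓ_p` unit ball of
`Y_K` is controlled, up to `ε`, by finitely many functionals `f_j`, where the number of the `f_j` only
depends on `K` and `ε` (`CompactDisc.exists_functional_net`). With the weights `m_i = ∑_j |f_j(y_i)|^p`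
the values `f_j(y_i)` are bounded multiples of `m_i ^ (1 / p)`; grouping the indices according to
these bounded multiples, and averaging over the groups with respect to the weights `m_i`, changes
the family by at most `ε` in the weak `ℓ_p` norm of `Y` (`CompactDisc.exists_discretisation`). For
`p = ∞` the weights are constant. The averages form a family the length of which depends only on
`K` and `ε`.

Applying the same to the remainder, and so on, all the tensors of the net are expanded simultaneously
into series of finite tensors, with fixed numbers of terms and with decay as fast as desired
(`CompactDisc.exists_expansion`). In these the limit exists along an ultrafilter, weak* in `X*` and in
norm in `Y`, and the limits form a series that represents `φ` (`exists_series`). As every block of the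
series is finite, its decay makes the series of all the elementary tensors converge unconditionally
(`exists_isRepresentation`).
-/

namespace PSumming

/-! ### Duality of finite `ℓ_p` families -/

section Duality

variable {p q : ℝ≥0∞} {E F : Type*} [NormedAddCommGroup E] [NormedAddCommGroup F] {n : ℕ}

theorem lpNorm_one (x : Fin n → E) : lpNorm 1 x = ∑ i, ‖x i‖ := by
  rw [lpNorm_eq_sum (by simp)]
  simp

theorem norm_le_lpNorm [Fact (1 ≤ p)] (x : Fin n → E) (i : Fin n) : ‖x i‖ ≤ lpNorm p x :=
  PiLp.norm_apply_le (toLp p x : PiLp p fun _ : Fin n => E) i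

theorem lpNorm_smul {𝕜 : Type*} [RCLike 𝕜] [NormedSpace 𝕜 E] [Fact (1 ≤ p)] (c : 𝕜)
    (x : Fin n → E) : lpNorm p (fun i => c • x i) = ‖c‖ * lpNorm p x :=
  norm_smul c (toLp p x : PiLp p fun _ : Fin n => E)

theorem lpNorm_sub_le [Fact (1 ≤ p)] (x y : Fin n → E) :
    lpNorm p (fun i => x i - y i) ≤ lpNorm p x + lpNorm p y :=
  norm_sub_le (toLp p x : PiLp p fun _ : Fin n => E) (toLp p y)

theorem continuous_lpNorm [Fact (1 ≤ p)] : Continuous fun x : Fin n → E => lpNorm p x :=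
  continuous_norm.comp (PiLp.continuous_toLp p fun _ : Fin n => E)

/-- Nonnegative scalars that norm a family in Hölder's inequality. -/
theorem exists_nonneg_norming [hqp : q.HolderConjugate p] (x : Fin n → E) :
    ∃ c : Fin n → ℝ, (∀ i, 0 ≤ c i) ∧ lpNorm q c ≤ 1 ∧ ∑ i, c i * ‖x i‖ = lpNorm p x := by
  rcases eq_or_ne p ∞ with rfl | hp
  · obtain rfl : q = 1 := hqp.symm.unique ∞ q 1
    rcases isEmpty_or_nonempty (Fin n) with h | h
    · exact ⟨fun _ => 0, fun _ => le_rfl, by simp [lpNorm_one], by simp [lpNorm_top]⟩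
    · obtain ⟨j, hj⟩ := exists_eq_ciSup_of_finite (f := fun i => ‖x i‖)
      refine ⟨Pi.single j 1, fun i => ?_, ?_, ?_⟩
      · by_cases h : i = j
        · subst h; simp
        · simp [h]
      · rw [lpNorm_one, Finset.sum_eq_single j] <;> simp +contextual
      · rw [lpNorm_top, ← hj, Finset.sum_eq_single j] <;> simp +contextual
  rcases eq_or_ne q ∞ with rfl | hq
  · obtain rfl : p = 1 := hqp.unique ∞ p 1
    refine ⟨fun _ => 1, fun _ => zero_le_one, ?_, ?_⟩
    · rw [lpNorm_top]
      exact Real.iSup_le (fun i => by simp) zero_le_one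
    · simp [lpNorm_one]
  · have h := ENNReal.HolderConjugate.toReal_of_ne_top (p := p) (q := q) hp hq
    obtain ⟨g, hg, hgx⟩ := (NNReal.isGreatest_Lp Finset.univ (fun i => ‖x i‖₊) h).1
    refine ⟨fun i => g i, fun i => (g i).2, ?_, ?_⟩
    · rw [lpNorm_eq_sum h.symm.pos]
      refine Real.rpow_le_one (by positivity) ?_ (by have := h.symm.pos; positivity)
      have : ((∑ i, g i ^ q.toReal : NNReal) : ℝ) ≤ 1 := by exact_mod_cast hg
      simpa using this
    · rw [lpNorm_eq_sum h.pos]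
      have := congrArg NNReal.toReal hgx
      push_cast at this
      simpa [mul_comm] using this

variable {𝕜 : Type*} [RCLike 𝕜] [NormedSpace 𝕜 E] [NormedSpace 𝕜 F]

variable (𝕜) in
/-- The duality of `ℓ_p(E)` and `ℓ_q(E*)`: the norm of a family in `ℓ_p(E)` is attained at a
family in the unit ball of `ℓ_q(E*)`. -/
theorem exists_norming [hqp : q.HolderConjugate p] (x : Fin n → E) :
    ∃ g : Fin n → StrongDual 𝕜 E, lpNorm q g ≤ 1 ∧ ∑ i, g i (x i) = (lpNorm p x : 𝕜) := by
  have := fact_left q p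
  obtain ⟨c, hc0, hc, hcx⟩ := exists_nonneg_norming (q := q) (p := p) x
  choose g hg hgx using fun i => exists_dual_vector'' 𝕜 (x i)
  refine ⟨fun i => (c i : 𝕜) • g i, (lpNorm_mono fun i => ?_).trans hc, ?_⟩
  · rw [norm_smul, RCLike.norm_ofReal]
    exact mul_le_of_le_one_right (abs_nonneg _) (hg i)
  · rw [← hcx]
    simp [hgx]

theorem norm_sum_apply_le [q.HolderConjugate p] (g : Fin n → StrongDual 𝕜 E) (x : Fin n → E) :
    ‖∑ i, g i (x i)‖ ≤ lpNorm q g * lpNorm p x :=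
  (norm_sum_le _ _).trans
    ((Finset.sum_le_sum fun i _ => (g i).le_opNorm (x i)).trans (holder_sum g x))

theorem norm_sum_smul_le_weakNorm [q.HolderConjugate p] (a : Fin n → 𝕜) (y : Fin n → F) :
    ‖∑ i, a i • y i‖ ≤ lpNorm q a * weakNorm 𝕜 p y := by
  have := fact_left q p
  have := fact_right q p
  obtain ⟨f, hf, hfy⟩ := exists_dual_vector'' 𝕜 (∑ i, a i • y i)
  have h : ‖∑ i, a i • y i‖ = ‖∑ i, a i * f (y i)‖ := by
    have : ∑ i, a i * f (y i) = f (∑ i, a i • y i) := by simp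
    rw [this, hfy]; simp
  rw [h]
  refine (norm_sum_le _ _).trans ?_
  simp only [norm_mul]
  exact (holder_sum a _).trans (mul_le_mul_of_nonneg_left (le_weakNorm f hf y) (lpNorm_nonneg _))

/-- The weak `ℓ_p` norm of `(y_i)` is at most the norm of `a ↦ ∑ a_i y_i` on `ℓ_q`. -/
theorem weakNorm_le_of_norm_sum_smul [q.HolderConjugate p] {y : Fin n → F} {C : ℝ}
    (h : ∀ a : Fin n → 𝕜, lpNorm q a ≤ 1 → ‖∑ i, a i • y i‖ ≤ C) : weakNorm 𝕜 p y ≤ C := by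
  have := fact_left q p
  refine weakNorm_le fun f hf => ?_
  obtain ⟨g, hg, hgf⟩ := exists_norming (q := q) (p := p) 𝕜 fun i => f (y i)
  have h1 : f (∑ i, g i 1 • y i) = (lpNorm p fun i => f (y i) : 𝕜) := by
    rw [← hgf, map_sum]
    refine Finset.sum_congr rfl fun i _ => ?_
    rw [map_smul, smul_eq_mul, mul_comm, ← smul_eq_mul, ← map_smul, smul_eq_mul, mul_one]
  have h2 : lpNorm p (fun i => f (y i)) ≤ ‖f (∑ i, g i 1 • y i)‖ := by
    rw [h1, RCLike.norm_ofReal]; exact le_abs_self _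
  refine h2.trans ((f.le_of_opNorm_le hf _).trans ?_)
  rw [one_mul]
  refine h _ ((lpNorm_mono fun i => ?_).trans hg)
  simpa using (g i).le_opNorm 1

theorem norm_le_weakNorm [Fact (1 ≤ p)] (y : Fin n → F) (i : Fin n) : ‖y i‖ ≤ weakNorm 𝕜 p y := by
  obtain ⟨f, hf, hfy⟩ := exists_dual_vector'' 𝕜 (y i)
  calc ‖y i‖ = ‖f (y i)‖ := by simp [hfy]
    _ ≤ lpNorm p (fun i => f (y i)) := norm_le_lpNorm (fun i => f (y i)) i
    _ ≤ _ := le_weakNorm f hf y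

theorem weakNorm_smul_le [Fact (1 ≤ p)] (c : 𝕜) (y : Fin n → F) :
    weakNorm 𝕜 p (fun i => c • y i) ≤ ‖c‖ * weakNorm 𝕜 p y :=
  weakNorm_le fun f hf => by
    simp only [map_smul]
    rw [lpNorm_smul]
    exact mul_le_mul_of_nonneg_left (le_weakNorm f hf y) (norm_nonneg c)

/-- The norm can be shared out freely between the two factors: a tensor of norm less than `s * t` has a representation whose
`ℓ_q` norm is at most `s` and whose weak `ℓ_p` norm is at most `t`. -/
theorem exists_rep_le [q.HolderConjugate p] {z : NuclearTensor 𝕜 q p E F} {s t : ℝ} (hs : 0 < s)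
    (ht : 0 < t) (h : ‖z‖ < s * t) :
    ∃ (n : ℕ) (x : Fin n → E) (y : Fin n → F), z = ∑ i, tmul q p (x i) (y i) ∧
      lpNorm q x ≤ s ∧ weakNorm 𝕜 p y ≤ t := by
  have := fact_left q p
  have := fact_right q p
  have hs' : (s : 𝕜) ≠ 0 := by simpa using hs.ne'
  have ht' : (t : 𝕜) ≠ 0 := by simpa using ht.ne'
  have h1 : ‖((s : 𝕜) * (t : 𝕜))⁻¹ • z‖ < 1 := by
    rw [norm_smul, norm_inv, norm_mul, RCLike.norm_ofReal, RCLike.norm_ofReal, abs_of_pos hs,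
      abs_of_pos ht, inv_mul_lt_iff₀ (by positivity), mul_one]
    exact h
  obtain ⟨n, x, y, hz, hx, hy⟩ := exists_rep_balanced h1
  rw [Real.one_rpow] at hx hy
  refine ⟨n, fun i => (s : 𝕜) • x i, fun i => (t : 𝕜) • y i, ?_, ?_, ?_⟩
  · simp only [tmul_smul_smul]
    rw [← Finset.smul_sum, ← hz, smul_smul, mul_inv_cancel₀ (mul_ne_zero hs' ht'), one_smul]
  · rw [lpNorm_smul, RCLike.norm_ofReal, abs_of_pos hs]
    exact mul_le_of_le_one_right hs.le hx
  · refine (weakNorm_smul_le _ _).trans ?_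
    rw [RCLike.norm_ofReal, abs_of_pos ht]
    exact mul_le_of_le_one_right ht.le hy

end Duality

/-! ### Averaging over the blocks of a partition -/

section Blocks

variable {p q : ℝ≥0∞} {𝕜 : Type*} [RCLike 𝕜] {E F : Type*} [NormedAddCommGroup E]
  [NormedSpace 𝕜 E] [NormedAddCommGroup F] [NormedSpace 𝕜 F] {n M : ℕ}

/-- The scalars `α` have `ℓ_p` norm at most one on each fibre of `c`. -/
def IsBlockBounded (p : ℝ≥0∞) (c : Fin n → Fin M) (α : Fin n → ℝ) : Prop :=
  ∀ A, lpNorm p (fun i => if c i = A then α i else 0) ≤ 1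

theorem IsBlockBounded.lpNorm_smul_le [Fact (1 ≤ p)] {c : Fin n → Fin M} {α : Fin n → ℝ}
    (h : IsBlockBounded p c α) (w : Fin M → E) :
    lpNorm p (fun i => (α i : 𝕜) • w (c i)) ≤ lpNorm p w := by
  rcases eq_or_ne p ∞ with rfl | hp
  · rw [lpNorm_top]
    refine Real.iSup_le (fun i => ?_) (lpNorm_nonneg _)
    have h1 := (norm_le_lpNorm (p := ∞) _ i).trans (h (c i))
    rw [if_pos rfl] at h1
    rw [norm_smul, RCLike.norm_ofReal]
    exact (mul_le_of_le_one_left (norm_nonneg _) h1).trans (norm_le_lpNorm w (c i))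
  · have hpos := toReal_pos_of_ne_top hp
    rw [lpNorm_eq_sum hpos, lpNorm_eq_sum hpos]
    refine Real.rpow_le_rpow (by positivity) ?_ (by positivity)
    rw [← Finset.sum_fiberwise Finset.univ c]
    refine Finset.sum_le_sum fun A _ => ?_
    have h1 := (h A).trans_eq (Real.one_rpow (1 / p.toReal)).symm
    rw [lpNorm_eq_sum hpos,
      Real.rpow_le_rpow_iff (by positivity) zero_le_one (by positivity)] at h1
    have h2 : ∑ i with c i = A, ‖α i‖ ^ p.toReal ≤ 1 := by
      rw [Finset.sum_filter]
      refine le_trans (Finset.sum_le_sum fun i _ => ?_) h1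
      split_ifs <;> simp [hpos.ne']
    calc ∑ i with c i = A, ‖(α i : 𝕜) • w (c i)‖ ^ p.toReal
        = ∑ i with c i = A, ‖α i‖ ^ p.toReal * ‖w A‖ ^ p.toReal := by
          refine Finset.sum_congr rfl fun i hi => ?_
          rw [(Finset.mem_filter.1 hi).2, norm_smul, RCLike.norm_ofReal,
            Real.mul_rpow (by positivity) (by positivity), Real.norm_eq_abs]
      _ ≤ ‖w A‖ ^ p.toReal := by
          rw [← Finset.sum_mul]
          exact mul_le_of_le_one_left (by positivity) h2

/-- The block sums `∑_{c i = A} β_i v_i`. -/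
def blockSum (𝕜 : Type*) [RCLike 𝕜] [NormedSpace 𝕜 E] (c : Fin n → Fin M) (β : Fin n → ℝ)
    (v : Fin n → E) (A : Fin M) : E :=
  ∑ i with c i = A, (β i : 𝕜) • v i

theorem map_blockSum (f : E →L[𝕜] F) (c : Fin n → Fin M) (β : Fin n → ℝ) (v : Fin n → E)
    (A : Fin M) : f (blockSum 𝕜 c β v A) = blockSum 𝕜 c β (fun i => f (v i)) A := by
  simp [blockSum]

/-- Block sums with coefficients in the unit ball of `ℓ_q` on each block do not increase `ℓ_p`
norms. The adjoint map, from `ℓ_q` to `ℓ_q`, is a contraction by `IsBlockBounded.lpNorm_smul_le`. -/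
theorem IsBlockBounded.lpNorm_blockSum_le [q.HolderConjugate p] {c : Fin n → Fin M}
    {β : Fin n → ℝ} (h : IsBlockBounded q c β) (v : Fin n → E) :
    lpNorm p (blockSum 𝕜 c β v) ≤ lpNorm p v := by
  have := fact_left q p
  have := fact_right q p
  obtain ⟨g, hg, hgv⟩ := exists_norming (q := q) (p := p) 𝕜 (blockSum 𝕜 c β v)
  have h1 : ∑ A, g A (blockSum 𝕜 c β v A) = ∑ i, ((β i : 𝕜) • g (c i)) (v i) := by
    rw [← Finset.sum_fiberwise Finset.univ c]
    refine Finset.sum_congr rfl fun A _ => ?_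
    rw [blockSum, map_sum]
    refine Finset.sum_congr rfl fun i hi => ?_
    rw [(Finset.mem_filter.1 hi).2, map_smul, _root_.smul_apply]
  have h2 : lpNorm p (blockSum 𝕜 c β v) ≤ ‖∑ A, g A (blockSum 𝕜 c β v A)‖ := by
    rw [hgv, RCLike.norm_ofReal]; exact le_abs_self _
  refine h2.trans ?_
  rw [h1]
  refine (norm_sum_apply_le (q := q) (p := p) _ v).trans
    (mul_le_of_le_one_left (lpNorm_nonneg _) ((h.lpNorm_smul_le g).trans hg))

theorem IsBlockBounded.weakNorm_blockSum_le [q.HolderConjugate p] {c : Fin n → Fin M}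
    {β : Fin n → ℝ} (h : IsBlockBounded q c β) (v : Fin n → E) :
    weakNorm 𝕜 p (blockSum 𝕜 c β v) ≤ weakNorm 𝕜 p v := by
  have := fact_right q p
  refine weakNorm_le fun f hf => ?_
  simp only [map_blockSum]
  exact (h.lpNorm_blockSum_le (p := p) fun i => f (v i)).trans (le_weakNorm f hf v)

theorem IsBlockBounded.weakNorm_smul_le [Fact (1 ≤ p)] {c : Fin n → Fin M} {α : Fin n → ℝ}
    (h : IsBlockBounded p c α) (w : Fin M → E) :
    weakNorm 𝕜 p (fun i => (α i : 𝕜) • w (c i)) ≤ weakNorm 𝕜 p w := by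
  refine weakNorm_le fun f hf => ?_
  simp only [map_smul]
  exact (h.lpNorm_smul_le fun A => f (w A)).trans (le_weakNorm f hf w)

/-- The power of the relative weights in the blocks, with exponent `1 / p`, is block bounded. -/
theorem isBlockBounded_rpow [Fact (1 ≤ p)] (c : Fin n → Fin M) {m : Fin n → ℝ}
    (hm : ∀ i, 0 ≤ m i) :
    IsBlockBounded p c fun i => (m i / ∑ j with c j = c i, m j) ^ (p⁻¹).toReal := by
  intro A
  rcases eq_or_ne p ∞ with rfl | hp
  · rw [lpNorm_top]
    refine Real.iSup_le (fun i => ?_) zero_le_one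
    split_ifs <;> simp
  · have hpos := toReal_pos_of_ne_top hp
    rw [lpNorm_eq_sum hpos]
    refine Real.rpow_le_one (by positivity) ?_ (by positivity)
    have h0 (i : Fin n) : 0 ≤ m i / ∑ j with c j = c i, m j :=
      div_nonneg (hm i) (Finset.sum_nonneg fun j _ => hm j)
    calc ∑ i, ‖if c i = A then (m i / ∑ j with c j = c i, m j) ^ (p⁻¹).toReal else 0‖ ^ p.toReal
        = ∑ i with c i = A, m i / ∑ j with c j = A, m j := by
          rw [Finset.sum_filter]
          refine Finset.sum_congr rfl fun i _ => ?_
          split_ifs with hi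
          · rw [Real.norm_of_nonneg (Real.rpow_nonneg (h0 i) _), ← Real.rpow_mul (h0 i),
              ENNReal.toReal_inv, inv_mul_cancel₀ hpos.ne', Real.rpow_one, hi]
          · simp [hpos.ne']
      _ ≤ 1 := by
          rw [← Finset.sum_div]
          exact div_self_le_one _

end Blocks

/-! ### Uniform discretisation of weakly summable families in a compact set -/

section Discretisation

variable {p q : ℝ≥0∞} {𝕜 : Type*} [RCLike 𝕜] {X Y : Type*} [NormedAddCommGroup X]
  [NormedSpace 𝕜 X] [NormedAddCommGroup Y] [NormedSpace 𝕜 Y]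

theorem exists_finite_net {V : Type*} [NormedAddCommGroup V] {s : Set V}
    (hs : TotallyBounded s) {δ : ℝ} (hδ : 0 < δ) :
    ∃ (N : ℕ) (v : Fin N → V), (∀ j, v j ∈ s) ∧ ∀ x ∈ s, ∃ j, ‖x - v j‖ < δ := by
  obtain ⟨t, hts, ht, hst⟩ := Metric.finite_approx_of_totallyBounded hs δ hδ
  have := ht.fintype
  refine ⟨Fintype.card t, fun j => ((Fintype.equivFin t).symm j : V), fun j => hts (Subtype.prop _),
    fun x hx => ?_⟩
  obtain ⟨y, hy, hxy⟩ := Set.mem_iUnion₂.1 (hst hx)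
  refine ⟨Fintype.equivFin t ⟨y, hy⟩, ?_⟩
  simp only [Equiv.symm_apply_apply]
  exact mem_ball_iff_norm.1 hxy

theorem totallyBounded_of_norm_le {V : Type*} [NormedAddCommGroup V] [ProperSpace V] {s : Set V}
    {C : ℝ} (h : ∀ x ∈ s, ‖x‖ ≤ C) : TotallyBounded s :=
  (isCompact_closedBall (0 : V) C).totallyBounded.subset fun x hx => by simpa using h x hx

namespace CompactDisc

variable (K : CompactDisc 𝕜 Y)

/-- The restrictions to `K` of the functionals in the unit ball of `Y*` form a totally bounded
subset of the space of continuous functions on `K`. -/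
theorem exists_functional_net {ε : ℝ} (hε : 0 < ε) :
    ∃ (N : ℕ) (f : Fin N → StrongDual 𝕜 Y), (∀ j, ‖f j‖ ≤ 1) ∧
      ∀ g : StrongDual 𝕜 Y, ‖g‖ ≤ 1 → ∃ j, ∀ x ∈ K.carrier, ‖(g - f j) x‖ ≤ ε := by
  obtain ⟨m, x, -, hx⟩ := exists_finite_net K.isCompact.totallyBounded
    (by positivity : 0 < ε / 4)
  have hS : TotallyBounded
      ((fun (f : StrongDual 𝕜 Y) (l : Fin m) => f (x l)) '' Metric.closedBall 0 1) := by
    refine totallyBounded_of_norm_le (C := ‖x‖) ?_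
    rintro _ ⟨f, hf, rfl⟩
    refine (pi_norm_le_iff_of_nonneg (norm_nonneg _)).2 fun l => ?_
    refine (f.le_of_opNorm_le (mem_closedBall_zero_iff.1 hf) _).trans ?_
    rw [one_mul]
    exact norm_le_pi_norm x l
  obtain ⟨N, v, hv, hnet⟩ := exists_finite_net hS (by positivity : 0 < ε / 2)
  choose f hf hfv using hv
  refine ⟨N, f, fun j => mem_closedBall_zero_iff.1 (hf j), fun g hg => ?_⟩
  obtain ⟨j, hj⟩ := hnet _ ⟨g, mem_closedBall_zero_iff.2 hg, rfl⟩
  refine ⟨j, fun u hu => ?_⟩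
  obtain ⟨l, hl⟩ := hx u hu
  have h1 : ‖(g - f j) (x l)‖ ≤ ε / 2 := by
    refine le_trans ?_ hj.le
    rw [← hfv j]
    exact norm_le_pi_norm ((fun l => g (x l)) - fun l => f j (x l)) l
  have h2 : ‖(g - f j) (u - x l)‖ ≤ 2 * (ε / 4) := by
    refine ((g - f j).le_opNorm _).trans (mul_le_mul ?_ hl.le (norm_nonneg _) zero_le_two)
    have := mem_closedBall_zero_iff.1 (hf j)
    exact (norm_sub_le _ _).trans (by linarith)
  calc ‖(g - f j) u‖ = ‖(g - f j) (x l) + (g - f j) (u - x l)‖ := by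
        rw [← map_add, add_sub_cancel]
    _ ≤ ε := (norm_add_le _ _).trans (by linarith)

variable {K} in
theorem norm_comp_Phi_le {f : StrongDual 𝕜 Y} {ε : ℝ} (hε : 0 < ε)
    (h : ∀ x ∈ K.carrier, ‖f x‖ ≤ ε) : ‖f.comp K.Phi‖ ≤ ε := by
  refine ContinuousLinearMap.opNorm_le_bound _ hε.le fun x => ?_
  rw [← div_le_iff₀' hε]
  refine le_csInf (dilations_nonempty x) ?_
  rintro r ⟨hr, k, hk, hx⟩
  have : f.comp K.Phi x = f (K.incl x) := rfl
  rw [div_le_iff₀' hε, this, hx, map_smul, norm_smul, RCLike.norm_ofReal, abs_of_nonneg hr,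
    mul_comm]
  exact mul_le_mul_of_nonneg_right (h k hk) hr

end CompactDisc

theorem toReal_inv_add_toReal_inv (p q : ℝ≥0∞) [q.HolderConjugate p] :
    (p⁻¹).toReal + (q⁻¹).toReal = 1 := by
  have hq : q⁻¹ ≠ ∞ := by simpa using (zero_lt_one.trans_le (fact_left q p).out).ne'
  have hp : p⁻¹ ≠ ∞ := by simpa using (zero_lt_one.trans_le (fact_right q p).out).ne'
  rw [← ENNReal.toReal_add hp hq, add_comm, ENNReal.HolderConjugate.inv_add_inv_eq_one q p,
    ENNReal.toReal_one]

/-- A dominating weight: `N` families in a ball of `ℓ_p` are dominated by `m ^ (1 / p)`, where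
`m` has bounded sum (or is constant, for `p = ∞`). -/
theorem exists_weight [Fact (1 ≤ p)] {N n : ℕ} {B : ℝ} (hB : 0 ≤ B) (h : Fin N → Fin n → 𝕜)
    (hh : ∀ j, lpNorm p (h j) ≤ B) :
    ∃ m : Fin n → ℝ, (∀ i, 0 ≤ m i) ∧ (∀ i, m i = 0 → p ≠ ∞) ∧
      (∀ j i, ‖h j i‖ ≤ max B 1 * m i ^ (p⁻¹).toReal) ∧
      lpNorm p (fun i => m i ^ (p⁻¹).toReal) ≤ max 1 ((N * B ^ p.toReal) ^ (p⁻¹).toReal) := by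
  rcases eq_or_ne p ∞ with rfl | hp
  · refine ⟨fun _ => 1, fun _ => zero_le_one, fun i hi => absurd hi one_ne_zero, fun j i => ?_, ?_⟩
    · simpa using Or.inl ((norm_le_lpNorm (p := ∞) (h j) i).trans (hh j))
    · rw [lpNorm_top]
      exact Real.iSup_le (fun i => by simp) (by simp)
  · have hpos := toReal_pos_of_ne_top hp
    have hm (i : Fin n) : 0 ≤ ∑ j, ‖h j i‖ ^ p.toReal := by positivity
    refine ⟨fun i => ∑ j, ‖h j i‖ ^ p.toReal, hm, fun _ _ => hp, fun j i => ?_,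
      le_max_of_le_right ?_⟩
    · refine le_trans ?_ (le_mul_of_one_le_left (Real.rpow_nonneg (hm i) _) (le_max_right _ _))
      rw [ENNReal.toReal_inv, Real.le_rpow_inv_iff_of_pos (norm_nonneg _) (hm i) hpos]
      exact Finset.single_le_sum (f := fun j => ‖h j i‖ ^ p.toReal) (fun j _ => by positivity)
        (Finset.mem_univ j)
    · rw [lpNorm_eq_sum hpos, one_div, ENNReal.toReal_inv]
      refine Real.rpow_le_rpow (by positivity) ?_ (by positivity)
      have (i : Fin n) : ‖(∑ j, ‖h j i‖ ^ p.toReal) ^ p.toReal⁻¹‖ ^ p.toReal =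
          ∑ j, ‖h j i‖ ^ p.toReal := by
        rw [Real.norm_of_nonneg (Real.rpow_nonneg (hm i) _), Real.rpow_inv_rpow (hm i) hpos.ne']
      simp only [this]
      rw [Finset.sum_comm]
      refine (Finset.sum_le_card_nsmul _ _ (B ^ p.toReal) fun j _ => ?_).trans (by simp)
      have h1 := hh j
      rw [lpNorm_eq_sum hpos, one_div, Real.rpow_inv_le_iff_of_pos (by positivity) hB hpos] at h1
      exact h1

/-- Finitely many families in a ball of `ℓ_p` are approximated in `ℓ_p` norm by their averages
over a partition, the size of which does not depend on the length of the families. Relative to a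
dominating weight `m ^ (1 / p)` all the families are bounded, so that their values can be
discretised; the averages are taken with respect to the measure with density `m`. -/
theorem exists_block_approx [q.HolderConjugate p] (N : ℕ) {B ε : ℝ} (hB : 0 ≤ B) (hε : 0 < ε) :
    ∃ M : ℕ, ∀ (n : ℕ) (h : Fin N → Fin n → 𝕜), (∀ j, lpNorm p (h j) ≤ B) →
      ∃ (c : Fin n → Fin M) (α β : Fin n → ℝ), IsBlockBounded p c α ∧ IsBlockBounded q c β ∧
        ∀ j, lpNorm p (fun i => h j i - (α i : 𝕜) • blockSum 𝕜 c β (h j) (c i)) ≤ ε := by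
  have := fact_left q p
  have := fact_right q p
  set T : ℝ := max 1 ((N * B ^ p.toReal) ^ (p⁻¹).toReal) with hT
  have hT0 : 0 < T := lt_max_of_lt_left one_pos
  have hδ : 0 < ε / T / 2 := by positivity
  obtain ⟨M, v, -, hv⟩ := exists_finite_net
    (isCompact_closedBall (0 : Fin N → 𝕜) (max B 1)).totallyBounded hδ
  refine ⟨M, fun n h hh => ?_⟩
  obtain ⟨m, hm, hm0, hhm, hmT⟩ := exists_weight hB h hh
  set w : Fin n → ℝ := fun i => m i ^ (p⁻¹).toReal with hw
  have hw0 (i : Fin n) : 0 ≤ w i := Real.rpow_nonneg (hm i) _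
  have hpq := toReal_inv_add_toReal_inv p q
  -- the families relative to the weight
  set k : Fin n → Fin N → 𝕜 := fun i j => ((w i : 𝕜))⁻¹ * h j i with hk
  have hkh (i : Fin n) (j : Fin N) : h j i = w i * k i j := by
    rcases eq_or_ne (w i) 0 with h0 | h0
    · have := hhm j i
      change _ ≤ _ * w i at this
      rw [h0, mul_zero, norm_le_zero_iff] at this
      rw [this, h0]; simp
    · have : (w i : 𝕜) ≠ 0 := by simpa using h0
      simp only [hk]
      rw [mul_inv_cancel_left₀ this]
  have hk1 (i : Fin n) : k i ∈ Metric.closedBall (0 : Fin N → 𝕜) (max B 1) := by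
    rw [mem_closedBall_zero_iff, pi_norm_le_iff_of_nonneg (by positivity)]
    intro j
    simp only [hk]
    rw [norm_mul, norm_inv, RCLike.norm_ofReal, abs_of_nonneg (hw0 i)]
    exact inv_mul_le_of_le_mul₀ (hw0 i) (by positivity) (by rw [mul_comm]; exact hhm j i)
  choose c hc using fun i => hv (k i) (hk1 i)
  set S : Fin n → ℝ := fun i => ∑ l with c l = c i, m l with hS
  refine ⟨c, fun i => (m i / S i) ^ (p⁻¹).toReal, fun i => (m i / S i) ^ (q⁻¹).toReal,
    isBlockBounded_rpow c hm, isBlockBounded_rpow c hm, fun j => ?_⟩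
  have key (i : Fin n) : ‖h j i - (((m i / S i) ^ (p⁻¹).toReal : ℝ) : 𝕜) •
      blockSum 𝕜 c (fun i => (m i / S i) ^ (q⁻¹).toReal) (h j) (c i)‖ ≤ ε / T * ‖w i‖ := by
    rcases (hm i).eq_or_lt with h0 | h0
    · have hp := toReal_pos_of_ne_top (hm0 i h0.symm)
      have hp' : (p⁻¹).toReal ≠ 0 := by rw [ENNReal.toReal_inv]; positivity
      have hwi : w i = 0 := by simp only [hw]; rw [← h0, Real.zero_rpow hp']
      rw [hkh, hwi, ← h0, zero_div, Real.zero_rpow hp']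
      simp
    have hS0 : 0 < S i := h0.trans_le
      (Finset.single_le_sum (f := m) (fun l _ => hm l) (by simp))
    -- the block average is a convex combination of the relative values in the cell
    have h1 : (((m i / S i) ^ (p⁻¹).toReal : ℝ) : 𝕜) •
        blockSum 𝕜 c (fun i => (m i / S i) ^ (q⁻¹).toReal) (h j) (c i) =
        (w i : 𝕜) * ∑ l with c l = c i, ((m l / S i : ℝ) : 𝕜) * k l j := by
      rw [blockSum, Finset.smul_sum, Finset.mul_sum]
      refine Finset.sum_congr rfl fun l hl => ?_
      have hl' : S l = S i := by simp only [hS]; rw [(Finset.mem_filter.1 hl).2]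
      have hSS : S i ^ (p⁻¹).toReal * S i ^ (q⁻¹).toReal = S i := by
        rw [← Real.rpow_add hS0, hpq, Real.rpow_one]
      have hmm : m l ^ (p⁻¹).toReal * m l ^ (q⁻¹).toReal = m l := by
        rw [← Real.rpow_add' (hm l) (by rw [hpq]; exact one_ne_zero), hpq, Real.rpow_one]
      have hreal : (m i / S i) ^ (p⁻¹).toReal * (m l / S i) ^ (q⁻¹).toReal * w l =
          w i * (m l / S i) := by
        simp only [hw]
        rw [Real.div_rpow (hm i) hS0.le, Real.div_rpow (hm l) hS0.le]
        calc _ = m i ^ (p⁻¹).toReal * (m l ^ (p⁻¹).toReal * m l ^ (q⁻¹).toReal) /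
              (S i ^ (p⁻¹).toReal * S i ^ (q⁻¹).toReal) := by ring
          _ = _ := by rw [hSS, hmm]; ring
      have hcast := congrArg (RCLike.ofReal (K := 𝕜)) hreal
      simp only [RCLike.ofReal_mul] at hcast
      rw [hkh l j, hl', smul_eq_mul, smul_eq_mul]
      linear_combination k l j * hcast
    have h2 : ∑ l with c l = c i, ((m l / S i : ℝ) : 𝕜) = 1 := by
      rw [← RCLike.ofReal_sum, ← Finset.sum_div]
      change ((S i / S i : ℝ) : 𝕜) = 1
      rw [div_self hS0.ne', RCLike.ofReal_one]
    have h3 : h j i - (((m i / S i) ^ (p⁻¹).toReal : ℝ) : 𝕜) •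
        blockSum 𝕜 c (fun i => (m i / S i) ^ (q⁻¹).toReal) (h j) (c i) =
        (w i : 𝕜) * ∑ l with c l = c i, ((m l / S i : ℝ) : 𝕜) * (k i j - k l j) := by
      rw [h1, hkh i j]
      simp only [mul_sub]
      rw [Finset.sum_sub_distrib, ← Finset.sum_mul, h2]
      ring
    rw [h3, norm_mul, RCLike.norm_ofReal, mul_comm, Real.norm_eq_abs]
    refine mul_le_mul_of_nonneg_right ?_ (abs_nonneg _)
    calc ‖∑ l with c l = c i, ((m l / S i : ℝ) : 𝕜) * (k i j - k l j)‖
        ≤ ∑ l with c l = c i, m l / S i * (ε / T) := by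
          refine norm_sum_le_of_le _ fun l hl => ?_
          rw [norm_mul, RCLike.norm_ofReal, abs_of_nonneg (div_nonneg (hm l) hS0.le)]
          refine mul_le_mul_of_nonneg_left ?_ (div_nonneg (hm l) hS0.le)
          have e1 := (norm_le_pi_norm (k i - v (c i)) j).trans (hc i).le
          have e2 := (norm_le_pi_norm (k l - v (c l)) j).trans (hc l).le
          rw [(Finset.mem_filter.1 hl).2] at e2
          calc ‖k i j - k l j‖ = ‖(k i - v (c i)) j - (k l - v (c i)) j‖ := by simp
            _ ≤ _ := (norm_sub_le _ _).trans (by linarith)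
      _ = ε / T := by
          rw [← Finset.sum_mul, ← Finset.sum_div]
          change S i / S i * _ = _
          rw [div_self hS0.ne', one_mul]
  calc _ ≤ ε / T * lpNorm p w := lpNorm_le_mul (by positivity) key
    _ ≤ ε / T * T := by gcongr
    _ = ε := div_mul_cancel₀ _ hT0.ne'

theorem sum_apply_eq_blockSum_add {Z : Type*} [NormedAddCommGroup Z] [NormedSpace 𝕜 Z] {n M : ℕ}
    (c : Fin n → Fin M) (α : Fin n → ℝ) (x : Fin n → StrongDual 𝕜 X) (y : Fin n → Z)
    (b : Fin M → Z) (U : Z →L[𝕜] X) :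
    ∑ i, x i (U (y i)) =
      ∑ A, blockSum 𝕜 c α x A (U (b A)) + ∑ i, x i (U (y i - (α i : 𝕜) • b (c i))) := by
  have h : ∑ A, blockSum 𝕜 c α x A (U (b A)) = ∑ i, x i (U ((α i : 𝕜) • b (c i))) := by
    rw [← Finset.sum_fiberwise Finset.univ c]
    refine Finset.sum_congr rfl fun A _ => ?_
    rw [blockSum, sum_apply]
    refine Finset.sum_congr rfl fun i hi => ?_
    rw [(Finset.mem_filter.1 hi).2, map_smul, map_smul, _root_.smul_apply]
  rw [h, ← Finset.sum_add_distrib]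
  refine Finset.sum_congr rfl fun i _ => ?_
  rw [← map_add, ← map_add, add_sub_cancel]

variable (K : CompactDisc 𝕜 Y)

/-- Every weakly `ℓ_p` bounded family in `Y_K` is, up to a small error in the weak `ℓ_p` norm of
`Y`, spread out from a family of block averages; the number of blocks depends only on `K`, on the
bound and on the error. -/
theorem CompactDisc.exists_discretisation [q.HolderConjugate p] {B ε : ℝ} (hB : 0 ≤ B)
    (hε : 0 < ε) :
    ∃ M : ℕ, ∀ (n : ℕ) (y : Fin n → K.Space), weakNorm 𝕜 p y ≤ B →
      ∃ (c : Fin n → Fin M) (α β : Fin n → ℝ), IsBlockBounded p c α ∧ IsBlockBounded q c β ∧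
        weakNorm 𝕜 p (fun i => y i - (α i : 𝕜) • blockSum 𝕜 c β y (c i)) ≤ 2 * B ∧
        weakNorm 𝕜 p (fun i => K.Phi (y i - (α i : 𝕜) • blockSum 𝕜 c β y (c i))) ≤ ε := by
  have := fact_left q p
  have := fact_right q p
  have hη : 0 < ε / (4 * (B + 1)) := by positivity
  obtain ⟨N, f, hf, hnet⟩ := K.exists_functional_net hη
  obtain ⟨M, hM⟩ := exists_block_approx (p := p) (q := q) (𝕜 := 𝕜) N
    (mul_nonneg (norm_nonneg K.Phi) hB) (half_pos hε)
  refine ⟨M, fun n y hy => ?_⟩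
  obtain ⟨c, α, β, hα, hβ, h⟩ := hM n (fun j i => (f j).comp K.Phi (y i)) fun j => by
    refine (lpNorm_apply_le_weakNorm _ y).trans (mul_le_mul ?_ hy (weakNorm_nonneg y) (norm_nonneg _))
    exact ((f j).opNorm_comp_le _).trans (mul_le_of_le_one_left (norm_nonneg _) (hf j))
  set r : Fin n → K.Space := fun i => y i - (α i : 𝕜) • blockSum 𝕜 c β y (c i) with hr
  have hrB : weakNorm 𝕜 p r ≤ 2 * B := by
    refine weakNorm_le fun f hf => ?_
    simp only [hr, map_sub]
    refine (lpNorm_sub_le _ _).trans ?_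
    have h1 := le_weakNorm (p := p) f hf y
    have h2 := (le_weakNorm (p := p) f hf _).trans
      ((hα.weakNorm_smul_le (blockSum 𝕜 c β y)).trans (hβ.weakNorm_blockSum_le y))
    linarith
  refine ⟨c, α, β, hα, hβ, hrB, weakNorm_le fun g hg => ?_⟩
  obtain ⟨j, hj⟩ := hnet g hg
  have h1 : lpNorm p (fun i => (f j).comp K.Phi (r i)) ≤ ε / 2 := by
    refine le_of_eq_of_le ?_ (h j)
    congr 1
    ext i
    rw [hr, map_sub, map_smul, map_blockSum]
  have h2 : lpNorm p (fun i => (g - f j).comp K.Phi (r i)) ≤ ε / 2 := by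
    refine (lpNorm_apply_le_weakNorm _ r).trans
      ((mul_le_mul (CompactDisc.norm_comp_Phi_le hη hj) hrB (weakNorm_nonneg r) hη.le).trans ?_)
    rw [div_mul_eq_mul_div, div_le_iff₀ (by positivity)]
    nlinarith
  calc lpNorm p (fun i => g (K.Phi (r i)))
      = lpNorm p (fun i => (f j).comp K.Phi (r i) + (g - f j).comp K.Phi (r i)) := by
        congr 1; ext i; simp
    _ ≤ ε := (lpNorm_add_le _ _).trans (by linarith)

end Discretisation

/-! ### Expansion of tensors over `Y_K` into series of finite tensors -/

section Expansion

variable {p q : ℝ≥0∞} {𝕜 : Type*} [RCLike 𝕜] {X Y : Type*} [NormedAddCommGroup X]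
  [NormedSpace 𝕜 X] [NormedAddCommGroup Y] [NormedSpace 𝕜 Y]

theorem norm_sum_apply_comp_le [q.HolderConjugate p] {U : Y →L[𝕜] X} {C : ℝ}
    (hU : IsSummingBound p U C) {n : ℕ} (x : Fin n → StrongDual 𝕜 X) (y : Fin n → Y) :
    ‖∑ i, x i (U (y i))‖ ≤ lpNorm q x * (C * weakNorm 𝕜 p y) := by
  have := fact_left q p
  exact (norm_sum_apply_le (q := q) (p := p) x fun i => U (y i)).trans
    (mul_le_mul_of_nonneg_left (hU.2 n y) (lpNorm_nonneg _))

/-- Iterated discretisation: the tensors `∑ x_i ⊗ y_i` with `(y_i)` in the weak `ℓ_p` unit ball of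
`Y_K` are expanded into series of finite tensors, the `k`-th one having `M k` terms and being of
prescribed smallness, uniformly in the given tensor. -/
theorem CompactDisc.exists_expansion [q.HolderConjugate p] (K : CompactDisc 𝕜 Y) {ε : ℕ → ℝ}
    (hε : ∀ k, 0 < ε k) :
    ∃ M : ℕ → ℕ, ∀ (n : ℕ) (x : Fin n → StrongDual 𝕜 X) (y : Fin n → K.Space),
      weakNorm 𝕜 p y ≤ 1 →
      ∃ (a : ∀ k, Fin (M k) → StrongDual 𝕜 X) (b : ∀ k, Fin (M k) → K.Space),
        (∀ k, lpNorm q (a k) ≤ lpNorm q x) ∧ (∀ k, weakNorm 𝕜 p (b k) ≤ 2 ^ k) ∧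
        (∀ k, weakNorm 𝕜 p (fun A => K.Phi (b (k + 1) A)) ≤ ε k) ∧
        ∀ (U : Y →L[𝕜] X) (C : ℝ), IsSummingBound p U C → ∀ k,
          ‖∑ i, x i (U (K.Phi (y i))) -
            ∑ l ∈ Finset.range (k + 1), ∑ A, a l A (U (K.Phi (b l A)))‖ ≤
              lpNorm q x * (C * ε k) := by
  have := fact_left q p
  have := fact_right q p
  choose M hM using fun k : ℕ => K.exists_discretisation (p := p) (q := q)
    (by positivity : (0 : ℝ) ≤ 2 ^ k) (hε k)
  refine ⟨M, fun n x y hy => ?_⟩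
  have step (k : ℕ) (r : {r : Fin n → K.Space // weakNorm 𝕜 p r ≤ 2 ^ k}) := hM k n r.1 r.2
  choose c α β hα hβ hB hr using step
  -- the successive remainders
  let s : ∀ k, {r : Fin n → K.Space // weakNorm 𝕜 p r ≤ 2 ^ k} := fun k =>
    Nat.rec ⟨y, by simpa using hy⟩ (fun k r =>
      ⟨fun i => r.1 i - (α k r i : 𝕜) • blockSum 𝕜 (c k r) (β k r) r.1 (c k r i),
        by rw [pow_succ']; exact hB k r⟩) k
  have hs (k : ℕ) (i : Fin n) : (s (k + 1)).1 i = (s k).1 i -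
      (α k (s k) i : 𝕜) • blockSum 𝕜 (c k (s k)) (β k (s k)) (s k).1 (c k (s k) i) := rfl
  have hsε (k : ℕ) : weakNorm 𝕜 p (fun i => K.Phi ((s (k + 1)).1 i)) ≤ ε k := hr k (s k)
  refine ⟨fun k => blockSum 𝕜 (c k (s k)) (α k (s k)) x,
    fun k => blockSum 𝕜 (c k (s k)) (β k (s k)) (s k).1, fun k => ?_, fun k => ?_, fun k => ?_,
    fun U C hU k => ?_⟩
  · have : p.HolderConjugate q := ENNReal.HolderConjugate.symm
    exact (hα k (s k)).lpNorm_blockSum_le x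
  · exact ((hβ k (s k)).weakNorm_blockSum_le _).trans (s k).2
  · simp only [map_blockSum]
    exact ((hβ (k + 1) (s (k + 1))).weakNorm_blockSum_le _).trans (hsε k)
  · have key (k : ℕ) : ∑ i, x i (U (K.Phi (y i))) =
        ∑ l ∈ Finset.range k, ∑ A, blockSum 𝕜 (c l (s l)) (α l (s l)) x A
          (U (K.Phi (blockSum 𝕜 (c l (s l)) (β l (s l)) (s l).1 A))) +
        ∑ i, x i (U (K.Phi ((s k).1 i))) := by
      induction k with
      | zero =>
        rw [Finset.sum_range_zero, zero_add]
        rfl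
      | succ k ih =>
        rw [ih, Finset.sum_range_succ, add_assoc]
        congr 1
        exact sum_apply_eq_blockSum_add (c k (s k)) (α k (s k)) x (s k).1
          (blockSum 𝕜 (c k (s k)) (β k (s k)) (s k).1) (U.comp K.Phi)
    rw [key (k + 1), add_sub_cancel_left]
    refine (norm_sum_apply_comp_le (q := q) hU x _).trans ?_
    gcongr
    · exact lpNorm_nonneg _
    · exact hU.1
    · exact hsε k

end Expansion

/-! ### Passage to the limit in families of bounded length -/

section Limits

variable {p q : ℝ≥0∞} {𝕜 : Type*} [RCLike 𝕜] {X Y : Type*} [NormedAddCommGroup X]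
  [NormedSpace 𝕜 X] [NormedAddCommGroup Y] [NormedSpace 𝕜 Y] {ι : Type*} (𝒰 : Ultrafilter ι)
  {M : ℕ}

theorem exists_tendsto_of_isCompact {V : Type*} [TopologicalSpace V] {s : Set V}
    (hs : IsCompact s) {u : ι → V} (hu : ∀ t, u t ∈ s) :
    ∃ v, Filter.Tendsto u 𝒰 (𝓝 v) := by
  obtain ⟨v, -, hv⟩ := hs.ultrafilter_le_nhds (𝒰.map u)
    (Filter.le_principal_iff.2 (Filter.mem_map.2 (Filter.univ_mem' hu)))
  exact ⟨v, hv⟩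

/-- Weak* limits along an ultrafilter of families in a ball of `ℓ_q(X*)` stay in that ball. -/
theorem exists_weakStar_limit [Fact (1 ≤ q)] {C : ℝ} {a : ι → Fin M → StrongDual 𝕜 X}
    (ha : ∀ t, lpNorm q (a t) ≤ C) :
    ∃ a' : Fin M → StrongDual 𝕜 X, lpNorm q a' ≤ C ∧
      ∀ A x, Filter.Tendsto (fun t => a t A x) 𝒰 (𝓝 (a' A x)) := by
  have hn (t : ι) (A : Fin M) : ‖a t A‖ ≤ C := (norm_le_lpNorm (a t) A).trans (ha t)
  have hex (A : Fin M) : ∃ f : StrongDual 𝕜 X, ∀ x,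
      Filter.Tendsto (fun t => a t A x) 𝒰 (𝓝 (f x)) := by
    obtain ⟨f, hf⟩ := exists_tendsto_of_isCompact 𝒰
      (WeakDual.isCompact_closedBall (𝕜 := 𝕜) (0 : StrongDual 𝕜 X) C)
      (u := fun t => StrongDual.toWeakDual (a t A)) fun t => by simpa using hn t A
    refine ⟨WeakDual.toStrongDual f, fun x => ?_⟩
    exact ((WeakDual.eval_continuous x).tendsto f).comp hf
  have hnorm (A : Fin M) : ∃ u : ℝ, Filter.Tendsto (fun t => ‖a t A‖) 𝒰 (𝓝 u) :=
    exists_tendsto_of_isCompact 𝒰 (isCompact_Icc (a := (0 : ℝ)) (b := C)) fun t =>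
      ⟨norm_nonneg _, hn t A⟩
  choose a' ha' using hex
  choose u hu using hnorm
  refine ⟨a', ?_, ha'⟩
  have h1 : lpNorm q u ≤ C := by
    have h := (continuous_lpNorm (p := q) (E := ℝ) (n := M)).tendsto u |>.comp
      (tendsto_pi_nhds.2 hu)
    refine le_of_tendsto h (Filter.Eventually.of_forall fun t => ?_)
    exact (lpNorm_mono fun A => by simp).trans (ha t)
  refine (lpNorm_mono fun A => ?_).trans h1
  have hu0 : 0 ≤ u A := ge_of_tendsto' (hu A) fun t => norm_nonneg _
  rw [Real.norm_of_nonneg hu0]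
  refine ContinuousLinearMap.opNorm_le_bound _ hu0 fun x => ?_
  exact le_of_tendsto_of_tendsto' (ha' A x).norm ((hu A).mul_const ‖x‖) fun t =>
    (a t A).le_opNorm x

theorem CompactDisc.mem_image_smul (K : CompactDisc 𝕜 Y) {x : K.Space} {r : ℝ} (h : ‖x‖ < r) :
    K.Phi x ∈ (fun k => (r : 𝕜) • k) '' K.carrier := by
  obtain ⟨s, ⟨hs, k, hk, hx⟩, hsr⟩ := exists_lt_of_csInf_lt (dilations_nonempty x) h
  have hr : 0 < r := hs.trans_lt hsr
  have hr' : (r : 𝕜) ≠ 0 := by simpa using hr.ne'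
  refine ⟨((s / r : ℝ) : 𝕜) • k, ?_, ?_⟩
  · have := K.absConvex k hk k hk ((s / r : ℝ) : 𝕜) 0 (by
      rw [RCLike.norm_ofReal, abs_of_nonneg (by positivity), norm_zero, add_zero]
      exact (div_le_one hr).2 hsr.le)
    simpa using this
  · change _ = K.incl x
    rw [hx]
    simp only [smul_smul, ← RCLike.ofReal_mul]
    rw [mul_div_cancel₀ _ hr.ne']

/-- As `K` is compact, families that are bounded in `Y_K` converge in the norm of `Y` along an
ultrafilter. -/
theorem CompactDisc.exists_limit [Fact (1 ≤ p)] (K : CompactDisc 𝕜 Y) {B : ℝ}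
    {b : ι → Fin M → K.Space} (hb : ∀ t, weakNorm 𝕜 p (b t) ≤ B) :
    ∃ b' : Fin M → Y, ∀ A, Filter.Tendsto (fun t => K.Phi (b t A)) 𝒰 (𝓝 (b' A)) := by
  have hn (t : ι) (A : Fin M) : ‖b t A‖ < B + 1 :=
    ((norm_le_weakNorm (b t) A).trans (hb t)).trans_lt (lt_add_one B)
  have hex (A : Fin M) : ∃ v : Y, Filter.Tendsto (fun t => K.Phi (b t A)) 𝒰 (𝓝 v) :=
    exists_tendsto_of_isCompact 𝒰
      (K.isCompact.image (continuous_const_smul ((B + 1 : ℝ) : 𝕜))) fun t =>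
      K.mem_image_smul (hn t A)
  choose b' hb' using hex
  exact ⟨b', hb'⟩

theorem weakNorm_le_of_tendsto [Fact (1 ≤ p)] {ε : ℝ} {b : ι → Fin M → Y} {b' : Fin M → Y}
    (hb : ∀ t, weakNorm 𝕜 p (b t) ≤ ε)
    (h : ∀ A, Filter.Tendsto (fun t => b t A) 𝒰 (𝓝 (b' A))) : weakNorm 𝕜 p b' ≤ ε := by
  refine weakNorm_le fun f hf => ?_
  have h1 : Filter.Tendsto (fun t A => f (b t A)) 𝒰 (𝓝 fun A => f (b' A)) :=
    tendsto_pi_nhds.2 fun A => (f.continuous.tendsto _).comp (h A)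
  exact le_of_tendsto ((continuous_lpNorm.tendsto _).comp h1)
    (Filter.Eventually.of_forall fun t => (le_weakNorm f hf (b t)).trans (hb t))

theorem tendsto_apply_of_tendsto {C : ℝ} {a : ι → StrongDual 𝕜 X} {a' : StrongDual 𝕜 X}
    {v : ι → X} {v' : X} (hC : ∀ t, ‖a t‖ ≤ C)
    (ha : ∀ x, Filter.Tendsto (fun t => a t x) 𝒰 (𝓝 (a' x)))
    (hv : Filter.Tendsto v 𝒰 (𝓝 v')) : Filter.Tendsto (fun t => a t (v t)) 𝒰 (𝓝 (a' v')) := by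
  have h1 : Filter.Tendsto (fun t => a t (v t - v')) 𝒰 (𝓝 0) := by
    have h2 : Filter.Tendsto (fun t => C * ‖v t - v'‖) 𝒰 (𝓝 0) := by
      have := ((hv.sub_const v').norm).const_mul C
      simpa using this
    exact squeeze_zero_norm (fun t => (a t).le_of_opNorm_le (hC t) _) h2
  have := h1.add (ha v')
  simpa using this

end Limits

/-! ### Approximation of functionals by finite tensors -/

section Separation

variable {p q : ℝ≥0∞} {𝕜 : Type*} [RCLike 𝕜] {X Y : Type*} [NormedAddCommGroup X]
  [NormedSpace 𝕜 X] [NormedAddCommGroup Y] [NormedSpace 𝕜 Y] [Fact (1 ≤ p)]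

/-- The functional `z ↦ trace (U ∘ z)` on algebraic tensors; `x ⊗ y` is taken to `x (U y)`. -/
noncomputable def traceMap (q : ℝ≥0∞) [q.HolderConjugate p] (U : SummingOp 𝕜 p Y X) :
    NuclearTensor 𝕜 q p (StrongDual 𝕜 X) Y →L[𝕜] 𝕜 :=
  (traceAlg 𝕜 X).comp (mapTensor U)

theorem traceMap_tmul [q.HolderConjugate p] (U : SummingOp 𝕜 p Y X) (x : StrongDual 𝕜 X) (y : Y) :
    traceMap q U (tmul q p x y) = x (U.toCLM y) := rfl

theorem traceMap_sum_smul [q.HolderConjugate p] {I : Type*} (s : Finset I) (c : I → 𝕜)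
    (U : I → SummingOp 𝕜 p Y X) (z : NuclearTensor 𝕜 q p (StrongDual 𝕜 X) Y) :
    traceMap q (∑ i ∈ s, c i • U i) z = ∑ i ∈ s, c i * traceMap q (U i) z := by
  obtain ⟨n, x, y, rfl⟩ := exists_rep z
  simp only [map_sum, traceMap_tmul, sum_apply, map_smul, _root_.smul_apply, smul_eq_mul,
    Finset.mul_sum]
  rw [Finset.sum_comm]

/-- The norm `π_p(U)` is the norm of the functional `z ↦ trace (U ∘ z)`. -/
theorem SummingOp.piNorm_le_of_traceMap [q.HolderConjugate p] (U : SummingOp 𝕜 p Y X) {C u : ℝ}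
    (hC : 0 < C) (h : ∀ z : NuclearTensor 𝕜 q p (StrongDual 𝕜 X) Y, ‖z‖ ≤ C →
      RCLike.re (traceMap q U z) ≤ u) : C * U.piNorm ≤ u := by
  have hu : 0 ≤ u := by simpa using h 0 (by simpa using hC.le)
  rw [← le_div_iff₀' hC]
  refine U.piNorm_le ⟨by positivity, fun n y => ?_⟩
  rcases (weakNorm_nonneg (𝕜 := 𝕜) (p := p) y).eq_or_lt with h0 | h0
  · have := U.isSummingBound_piNorm.2 n y
    rw [← h0, mul_zero] at this ⊢
    exact this
  obtain ⟨g, hg, hgU⟩ := exists_norming (q := q) (p := p) 𝕜 fun i => U.toCLM (y i)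
  have hz := h (((C / weakNorm 𝕜 p y : ℝ) : 𝕜) • ∑ i, tmul q p (g i) (y i)) (by
    rw [norm_smul, RCLike.norm_ofReal, abs_of_pos (by positivity), div_mul_eq_mul_div,
      div_le_iff₀ h0]
    refine mul_le_mul_of_nonneg_left ((norm_le_of_rep g y).trans ?_) hC.le
    exact mul_le_of_le_one_left h0.le hg)
  rw [map_smul, map_sum] at hz
  simp only [traceMap_tmul] at hz
  rw [hgU, smul_eq_mul, ← RCLike.ofReal_mul, RCLike.ofReal_re, div_mul_eq_mul_div,
    div_le_iff₀ h0] at hz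
  rwa [div_mul_eq_mul_div, le_div_iff₀' hC]

/-- A functional dominated by `C * π_p(U Φ_K)` is a pointwise limit of the functionals given by
tensors in the ball of radius `C` of `X* ⊗ Y_K`. This is separation of a point from a convex set in
finite dimensional spaces. -/
theorem exists_tensor_approx [q.HolderConjugate p] {R : Submodule 𝕜 (SummingOp 𝕜 p Y X)}
    {φ : R →ₗ[𝕜] 𝕜} {K : CompactDisc 𝕜 Y} {C : ℝ} (hC : 0 < C)
    (hφ : ∀ U : R, ‖φ U‖ ≤ C * (SummingOp.precomp K.Phi U.1).piNorm) (I : Finset R) {η : ℝ}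
    (hη : 0 < η) :
    ∃ z : NuclearTensor 𝕜 q p (StrongDual 𝕜 X) K.Space, ‖z‖ ≤ C ∧
      ∀ U ∈ I, ‖traceMap q (SummingOp.precomp K.Phi U.1) z - φ U‖ < η := by
  classical
  let _ : NormedSpace ℝ (NuclearTensor 𝕜 q p (StrongDual 𝕜 X) K.Space) :=
    NormedSpace.restrictScalars ℝ 𝕜 _
  have _ : IsScalarTower ℝ 𝕜 (NuclearTensor 𝕜 q p (StrongDual 𝕜 X) K.Space) :=
    IsScalarTower.of_algebraMap_smul fun _ _ => rfl
  let T : NuclearTensor 𝕜 q p (StrongDual 𝕜 X) K.Space →ₗ[ℝ] (I → 𝕜) :=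
    (LinearMap.pi fun U : I =>
      (traceMap q (SummingOp.precomp K.Phi U.1.1)).toLinearMap).restrictScalars ℝ
  suffices h : (fun U : I => φ U.1) ∈ closure (T '' Metric.closedBall 0 C) by
    obtain ⟨_, ⟨z, hz, rfl⟩, hd⟩ := Metric.mem_closure_iff.1 h η hη
    refine ⟨z, mem_closedBall_zero_iff.1 hz, fun U hU => ?_⟩
    rw [dist_comm, dist_eq_norm] at hd
    exact (norm_le_pi_norm (T z - fun U : I => φ U.1) ⟨U, hU⟩).trans_lt hd
  by_contra hmem
  obtain ⟨f, u, hfu, huf⟩ := RCLike.geometric_hahn_banach_closed_point (𝕜 := 𝕜)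
    (((convex_closedBall _ C).linear_image T).closure) isClosed_closure hmem
  have hf (v : I → 𝕜) : f v = ∑ U, f (Pi.single U 1) * v U := by
    have := LinearMap.pi_apply_eq_sum_univ f.toLinearMap v
    simp only [ContinuousLinearMap.coe_coe, smul_eq_mul] at this
    rw [this]
    refine Finset.sum_congr rfl fun U _ => ?_
    rw [mul_comm]
    congr 2
    ext W
    simp [Pi.single_apply, eq_comm]
  set V : R := ∑ U : I, f (Pi.single U 1) • U.1 with hV
  have h1 : C * (SummingOp.precomp K.Phi V.1).piNorm ≤ u := by
    refine SummingOp.piNorm_le_of_traceMap (q := q) _ hC fun z hz => ?_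
    refine le_of_eq_of_le ?_ (hfu (T z) (subset_closure ⟨z, mem_closedBall_zero_iff.2 hz, rfl⟩)).le
    rw [hf, hV]
    congr 1
    have : SummingOp.precomp K.Phi (∑ U : I, f (Pi.single U 1) • U.1 : R).1 =
        ∑ U : I, f (Pi.single U 1) • SummingOp.precomp K.Phi U.1.1 := by
      simp
    rw [this, traceMap_sum_smul]
    rfl
  have h2 : f (fun U : I => φ U.1) = φ V := by
    rw [hf, hV, map_sum]
    simp
  rw [h2] at huf
  exact absurd ((RCLike.re_le_norm _).trans ((hφ V).trans h1)) (not_le.2 huf)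

/-- The functionals dominated by `π_p(U Φ_K)` are given by series of finite tensors, with
arbitrarily fast decay of the weak `ℓ_p` norms. -/
theorem exists_series [q.HolderConjugate p] {R : Submodule 𝕜 (SummingOp 𝕜 p Y X)}
    {φ : R →ₗ[𝕜] 𝕜} {K : CompactDisc 𝕜 Y} {C : ℝ} (hC : 0 < C)
    (hφ : ∀ U : R, ‖φ U‖ ≤ C * (SummingOp.precomp K.Phi U.1).piNorm) {ε : ℕ → ℝ}
    (hε : ∀ k, 0 < ε k) (hε0 : Filter.Tendsto ε Filter.atTop (𝓝 0)) :
    ∃ (M : ℕ → ℕ) (a : ∀ k, Fin (M k) → StrongDual 𝕜 X) (b : ∀ k, Fin (M k) → Y),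
      (∀ k, lpNorm q (a k) ≤ C + 1) ∧ (∀ k, weakNorm 𝕜 p (b (k + 1)) ≤ ε k) ∧
      ∀ U : R, Filter.Tendsto
        (fun k => ∑ l ∈ Finset.range (k + 1), ∑ A, a l A (U.1.toCLM (b l A))) Filter.atTop
        (𝓝 (φ U)) := by
  classical
  have := fact_left q p
  obtain ⟨M, hM⟩ := K.exists_expansion (X := X) (p := p) (q := q) hε
  -- a net of tensors that converges to `φ`, indexed by finite subsets of `R` and by precisions
  have hnet (t : Finset R × ℕ) : ∃ (n : ℕ) (x : Fin n → StrongDual 𝕜 X) (y : Fin n → K.Space),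
      lpNorm q x ≤ C + 1 ∧ weakNorm 𝕜 p y ≤ 1 ∧
        ∀ U ∈ t.1, ‖∑ i, x i (U.1.toCLM (K.Phi (y i))) - φ U‖ < 1 / ((t.2 : ℝ) + 1) := by
    obtain ⟨z, hz, hzφ⟩ := exists_tensor_approx (q := q) hC hφ t.1
      (by positivity : 0 < 1 / ((t.2 : ℝ) + 1))
    obtain ⟨n, x, y, hzr, hx, hy⟩ := exists_rep_le (by positivity : 0 < C + 1) one_pos
      (hz.trans_lt (by linarith : C < (C + 1) * 1))
    refine ⟨n, x, y, hx, hy, fun U hU => ?_⟩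
    have := hzφ U hU
    rw [hzr, map_sum] at this
    exact this
  choose n x y hx hy hxy using hnet
  choose a b ha hb hbε hab using fun t => hM (n t) (x t) (y t) (hy t)
  let 𝒰 : Ultrafilter (Finset R × ℕ) := Ultrafilter.of Filter.atTop
  have h𝒰 : (𝒰 : Filter (Finset R × ℕ)) ≤ Filter.atTop := Ultrafilter.of_le _
  have haC (k : ℕ) (t) : lpNorm q (a t k) ≤ C + 1 := (ha t k).trans (hx t)
  choose a' ha' hlima using fun k => exists_weakStar_limit 𝒰 (haC k)
  choose b' hlimb using fun k => K.exists_limit 𝒰 fun t => hb t k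
  refine ⟨M, a', b', ha', fun k => ?_, fun U => ?_⟩
  · exact weakNorm_le_of_tendsto 𝒰 (fun t => hbε t k) (hlimb (k + 1))
  have hlim1 : Filter.Tendsto (fun t => ∑ i, x t i (U.1.toCLM (K.Phi (y t i)))) 𝒰 (𝓝 (φ U)) := by
    refine Filter.Tendsto.mono_left ?_ h𝒰
    rw [Metric.tendsto_nhds]
    intro η hη
    obtain ⟨m, hm⟩ := exists_nat_one_div_lt hη
    filter_upwards [Filter.eventually_ge_atTop (({U}, m) : Finset R × ℕ)] with t ht
    rw [dist_eq_norm]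
    refine (hxy t U (ht.1 (Finset.mem_singleton_self U))).trans (lt_of_le_of_lt ?_ hm)
    gcongr
    exact ht.2
  have hlim2 (k : ℕ) : Filter.Tendsto
      (fun t => ∑ l ∈ Finset.range (k + 1), ∑ A, a t l A (U.1.toCLM (K.Phi (b t l A)))) 𝒰
      (𝓝 (∑ l ∈ Finset.range (k + 1), ∑ A, a' l A (U.1.toCLM (b' l A)))) := by
    refine tendsto_finsetSum _ fun l _ => tendsto_finsetSum _ fun A _ => ?_
    exact tendsto_apply_of_tendsto 𝒰 (fun t => (norm_le_lpNorm (a t l) A).trans (haC l t))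
      (hlima l A) ((U.1.toCLM.continuous.tendsto _).comp (hlimb l A))
  have hbound (k : ℕ) : ‖∑ l ∈ Finset.range (k + 1), ∑ A, a' l A (U.1.toCLM (b' l A)) - φ U‖ ≤
      (C + 1) * (U.1.piNorm * ε k) := by
    rw [norm_sub_rev]
    refine le_of_tendsto (hlim1.sub (hlim2 k)).norm (Filter.Eventually.of_forall fun t => ?_)
    refine (hab t U.1.toCLM _ U.1.isSummingBound_piNorm k).trans ?_
    exact mul_le_mul_of_nonneg_right (hx t) (mul_nonneg U.1.piNorm_nonneg (hε k).le)
  rw [tendsto_iff_norm_sub_tendsto_zero]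
  refine squeeze_zero (fun _ => norm_nonneg _) hbound ?_
  simpa using (hε0.const_mul U.1.piNorm).const_mul (C + 1)

end Separation

/-! ### Series over a sequence of finite blocks -/

section Series

variable {p q : ℝ≥0∞} {E F : Type*} [NormedAddCommGroup E] [NormedAddCommGroup F] {M : ℕ → ℕ}

/-- A series over blocks converges unconditionally as soon as all the partial sums within the
blocks have a summable bound; absolute convergence would depend on the lengths of the blocks. -/
theorem summable_sigma_of_block_bound {V : Type*} [SeminormedAddCommGroup V] [CompleteSpace V]
    {f : (Σ k, Fin (M k)) → V} {u : ℕ → ℝ} (hu : Summable u)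
    (hf : ∀ (k : ℕ) (S : Finset (Fin (M k))), ‖∑ A ∈ S, f ⟨k, A⟩‖ ≤ u k) : Summable f := by
  classical
  refine summable_iff_vanishing_norm.2 fun ε hε => ?_
  obtain ⟨s, hs⟩ := summable_iff_vanishing_norm.1 hu ε hε
  refine ⟨s.sigma fun _ => Finset.univ, fun t ht => ?_⟩
  rw [← t.sigma_image_fst_preimage_mk, Finset.sum_sigma]
  refine (norm_sum_le_of_le _ fun k _ => hf k _).trans_lt
    ((le_abs_self _).trans_lt (hs (t.image Sigma.fst) ?_))
  rw [Finset.disjoint_left] at ht ⊢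
  intro k hk hks
  obtain ⟨v, hv, rfl⟩ := Finset.mem_image.1 hk
  exact ht hv (Finset.mem_sigma.2 ⟨hks, Finset.mem_univ _⟩)

theorem memℓp_sigma_of_block_bound [Fact (1 ≤ p)] {v : (Σ k, Fin (M k)) → E} {C : ℝ}
    (hv : ∀ k, lpNorm p (fun A => v ⟨k, A⟩) ≤ C * (1 / 2) ^ k) : Memℓp v p := by
  have hC : 0 ≤ C := by simpa using (lpNorm_nonneg _).trans (hv 0)
  rcases eq_or_ne p ∞ with rfl | hp
  · refine memℓp_infty ⟨C, ?_⟩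
    rintro _ ⟨⟨k, A⟩, rfl⟩
    refine (norm_le_lpNorm (p := ∞) (fun A => v ⟨k, A⟩) A).trans ((hv k).trans ?_)
    exact mul_le_of_le_one_right hC (pow_le_one₀ (by norm_num) (by norm_num))
  · have hpos := toReal_pos_of_ne_top hp
    rw [memℓp_gen_iff hpos, summable_sigma_of_nonneg fun s => by positivity]
    refine ⟨fun k => Summable.of_finite, ?_⟩
    refine Summable.of_nonneg_of_le (fun k => tsum_nonneg fun A => by positivity) (fun k => ?_)
      ((summable_geometric_of_lt_one (r := (1 / 2 : ℝ) ^ p.toReal) (by positivity)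
        (Real.rpow_lt_one (by norm_num) (by norm_num) hpos)).mul_left (C ^ p.toReal))
    have h := hv k
    rw [lpNorm_eq_sum hpos, one_div, Real.rpow_inv_le_iff_of_pos (by positivity) (by positivity)
      hpos, Real.mul_rpow hC (by positivity)] at h
    rw [tsum_fintype]
    refine h.trans_eq ?_
    rw [← Real.rpow_natCast, ← Real.rpow_natCast, ← Real.rpow_mul (by norm_num),
      ← Real.rpow_mul (by norm_num), mul_comm p.toReal]

theorem tendsto_cofinite_of_block_bound [Fact (1 ≤ p)] {v : (Σ k, Fin (M k)) → E} {C : ℝ}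
    (hv : ∀ k, lpNorm p (fun A => v ⟨k, A⟩) ≤ C * (1 / 2) ^ k) :
    Filter.Tendsto v Filter.cofinite (𝓝 0) := by
  rw [Metric.tendsto_nhds]
  intro ε hε
  have h0 : Filter.Tendsto (fun k : ℕ => C * (1 / 2 : ℝ) ^ k) Filter.atTop (𝓝 0) := by
    simpa using (tendsto_pow_atTop_nhds_zero_of_lt_one (r := (1 / 2 : ℝ)) (by norm_num)
      (by norm_num)).const_mul C
  obtain ⟨n, hn⟩ := Filter.eventually_atTop.1 (h0.eventually (gt_mem_nhds hε))
  refine (Finset.finite_toSet ((Finset.range n).sigma fun k =>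
    (Finset.univ : Finset (Fin (M k))))).subset ?_
  rintro ⟨k, A⟩ hk
  by_contra hkn
  refine hk ?_
  have : n ≤ k := by simpa using hkn
  rw [Set.mem_ofPred_eq, dist_zero_right]
  exact ((norm_le_lpNorm (fun A => v ⟨k, A⟩) A).trans (hv k)).trans_lt (hn k this)

theorem norm_sum_tmul_le {𝕜 : Type*} [RCLike 𝕜] [NormedSpace 𝕜 E] [NormedSpace 𝕜 F]
    [q.HolderConjugate p] {n : ℕ} (x : Fin n → E) (y : Fin n → F) (S : Finset (Fin n)) :
    ‖∑ i ∈ S, tmul (𝕜 := 𝕜) q p (x i) (y i)‖ ≤ lpNorm q x * weakNorm 𝕜 p y := by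
  classical
  have := fact_left q p
  have := fact_right q p
  have h : ∑ i ∈ S, tmul (𝕜 := 𝕜) q p (x i) (y i) =
      ∑ i, tmul q p (if i ∈ S then x i else 0) (y i) := by
    rw [← Finset.sum_filter_add_sum_filter_not Finset.univ (· ∈ S)]
    rw [Finset.sum_eq_zero (s := Finset.univ.filter (· ∉ S)), add_zero, Finset.filter_mem_eq_inter,
      Finset.univ_inter]
    · exact Finset.sum_congr rfl fun i hi => by rw [if_pos hi]
    · intro i hi
      rw [if_neg (Finset.mem_filter.1 hi).2]
      exact TensorProduct.zero_tmul _ _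
  rw [h]
  refine (norm_le_of_rep _ _).trans (mul_le_mul_of_nonneg_right ?_ (weakNorm_nonneg y))
  refine lpNorm_mono fun i => ?_
  split_ifs <;> simp

/-- Extension by zero of a family with a countable index set to a sequence. -/
noncomputable def toSeq {ι : Type*} [Encodable ι] (v : ι → E) : ℕ → E :=
  Function.extend Encodable.encode v fun _ => 0

variable {ι : Type*} [Encodable ι]

theorem toSeq_encode (v : ι → E) (s : ι) : toSeq v (Encodable.encode s) = v s :=
  Encodable.encode_injective.extend_apply v _ s

theorem toSeq_of_notMem (v : ι → E) {n : ℕ} (h : n ∉ Set.range (Encodable.encode : ι → ℕ)) :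
    toSeq v n = 0 := Function.extend_apply' v _ n h

theorem map_toSeq (f : E → F) (hf : f 0 = 0) (v : ι → E) (n : ℕ) :
    f (toSeq v n) = toSeq (fun s => f (v s)) n := by
  by_cases h : n ∈ Set.range (Encodable.encode : ι → ℕ)
  · obtain ⟨s, rfl⟩ := h
    rw [toSeq_encode, toSeq_encode]
  · rw [toSeq_of_notMem v h, toSeq_of_notMem _ h, hf]

theorem memℓp_toSeq [Fact (1 ≤ p)] {v : ι → E} (hv : Memℓp v p) : Memℓp (toSeq v) p := by
  rcases eq_or_ne p ∞ with rfl | hp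
  · obtain ⟨C, hC⟩ := memℓp_infty_iff.1 hv
    refine memℓp_infty ⟨max C 0, ?_⟩
    rintro _ ⟨n, rfl⟩
    by_cases h : n ∈ Set.range (Encodable.encode : ι → ℕ)
    · obtain ⟨s, rfl⟩ := h
      dsimp only
      rw [toSeq_encode]
      exact le_max_of_le_left (hC ⟨s, rfl⟩)
    · dsimp only
      rw [toSeq_of_notMem v h, norm_zero]
      exact le_max_right _ _
  · have hpos := toReal_pos_of_ne_top hp
    rw [memℓp_gen_iff hpos] at hv ⊢
    refine (Encodable.encode_injective.summable_iff (f := fun n => ‖toSeq v n‖ ^ p.toReal)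
      (g := (Encodable.encode : ι → ℕ)) fun n hn => ?_).1 ?_
    · rw [toSeq_of_notMem v hn, norm_zero, Real.zero_rpow hpos.ne']
    · simpa only [Function.comp_def, toSeq_encode] using hv

theorem tendsto_toSeq {v : ι → E} (hv : Filter.Tendsto v Filter.cofinite (𝓝 0)) :
    Filter.Tendsto (toSeq v) Filter.atTop (𝓝 0) := by
  rw [← Nat.cofinite_eq_atTop, Metric.tendsto_nhds]
  intro ε hε
  have h := Metric.tendsto_nhds.1 hv ε hε
  refine (Set.Finite.image Encodable.encode (Filter.eventually_cofinite.1 h)).subset fun n hn => ?_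
  by_cases hr : n ∈ Set.range (Encodable.encode : ι → ℕ)
  · obtain ⟨s, rfl⟩ := hr
    refine ⟨s, ?_, rfl⟩
    simpa [toSeq_encode] using hn
  · refine absurd ?_ hn
    simpa [toSeq_of_notMem v hr] using hε

variable {𝕜 : Type*} [RCLike 𝕜] [NormedSpace 𝕜 E] [NormedSpace 𝕜 F]

/-- A series of finite tensors whose `ℓ_q` and weak `ℓ_p` norms decay geometrically converges to
an element with a representation by sequences. -/
theorem exists_isRepresentation [q.HolderConjugate p] {x : ∀ k, Fin (M k) → E}
    {y : ∀ k, Fin (M k) → F} {C D : ℝ} (hx : ∀ k, lpNorm q (x k) ≤ C * (1 / 2) ^ k)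
    (hy : ∀ k, weakNorm 𝕜 p (y k) ≤ D * (1 / 2) ^ k) :
    ∃ z : CompletedTensor 𝕜 q p E F, (∃ (x' : ℕ → E) (y' : ℕ → F), IsRepresentation z x' y') ∧
      HasSum (fun s : Σ k, Fin (M k) => toCompleted 𝕜 q p E F (tmul q p (x s.1 s.2) (y s.1 s.2)))
        z := by
  have := fact_left q p
  have := fact_right q p
  have hC : 0 ≤ C := by simpa using (lpNorm_nonneg _).trans (hx 0)
  have hD : 0 ≤ D := by simpa using (weakNorm_nonneg _).trans (hy 0)
  have hsum : Summable fun s : Σ k, Fin (M k) =>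
      toCompleted 𝕜 q p E F (tmul q p (x s.1 s.2) (y s.1 s.2)) := by
    refine summable_sigma_of_block_bound (u := fun k : ℕ => C * D * (1 / 4) ^ k)
      ((summable_geometric_of_lt_one (by norm_num) (by norm_num)).mul_left _) fun k S => ?_
    rw [← map_sum]
    refine (UniformSpace.Completion.norm_coe _).trans_le ((norm_sum_tmul_le _ _ S).trans ?_)
    refine (mul_le_mul (hx k) (hy k) (weakNorm_nonneg _) (by positivity)).trans_eq ?_
    rw [mul_mul_mul_comm, ← mul_pow]
    norm_num
  refine ⟨_, ⟨toSeq fun s : Σ k, Fin (M k) => x s.1 s.2, toSeq fun s : Σ k, Fin (M k) => y s.1 s.2,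
    ?_, ?_, fun f => ?_, ?_⟩, hsum.hasSum⟩
  · exact memℓp_toSeq (memℓp_sigma_of_block_bound hx)
  · exact tendsto_toSeq (tendsto_cofinite_of_block_bound hx)
  · simp only [map_toSeq f (map_zero f)]
    refine memℓp_toSeq (memℓp_sigma_of_block_bound (C := ‖f‖ * D) fun k => ?_)
    rw [mul_assoc]
    exact (lpNorm_apply_le_weakNorm f (y k)).trans
      (mul_le_mul_of_nonneg_left (hy k) (norm_nonneg f))
  · refine (Encodable.encode_injective.hasSum_iff (g := (Encodable.encode : (Σ k, Fin (M k)) → ℕ))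
      fun n hn => ?_).1 ?_
    · have : tmul (𝕜 := 𝕜) q p (toSeq (fun s : Σ k, Fin (M k) => x s.1 s.2) n)
          (toSeq (fun s : Σ k, Fin (M k) => y s.1 s.2) n) = 0 := by
        rw [toSeq_of_notMem _ hn]
        exact TensorProduct.zero_tmul _ _
      rw [this, map_zero]
    · simpa only [Function.comp_def, toSeq_encode] using hsum.hasSum

end Series

/-! ### Compact sets from weakly summable families -/

section CompactSet

variable {p q : ℝ≥0∞} {𝕜 : Type*} [RCLike 𝕜] {Y : Type*} [NormedAddCommGroup Y]
  [NormedSpace 𝕜 Y] [CompleteSpace Y]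

/-- Finite families with geometrically decaying weak `ℓ_p` norms lie, with uniformly bounded weak
`ℓ_p` norms, in `Y_K` for a single compact set `K`: the set of all sums `∑_k ∑_i a_{k,i} y_{k,i}`
with `(a_{k,i})_i` in the unit ball of `ℓ_q` for all `k`. -/
theorem exists_compactDisc [q.HolderConjugate p] {M : ℕ → ℕ} {y : ∀ k, Fin (M k) → Y}
    (hy : ∀ k, weakNorm 𝕜 p (y k) ≤ (1 / 2) ^ k) :
    ∃ K : CompactDisc 𝕜 Y, ∀ k, ∃ v : Fin (M k) → K.Space, (∀ i, K.Phi (v i) = y k i) ∧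
      weakNorm 𝕜 p v ≤ 1 := by
  have := fact_left q p
  have := fact_right q p
  let S : Set (∀ k, Fin (M k) → 𝕜) := Set.univ.pi fun k => {a | lpNorm q a ≤ 1}
  let G : (∀ k, Fin (M k) → 𝕜) → ℕ → Y := fun a k => ∑ i, a k i • y k i
  have hS : IsCompact S := by
    refine isCompact_univ_pi fun k => ?_
    refine (isCompact_closedBall (0 : Fin (M k) → 𝕜) 1).of_isClosed_subset
      (isClosed_le continuous_lpNorm continuous_const) fun a ha => ?_
    rw [mem_closedBall_zero_iff, pi_norm_le_iff_of_nonneg zero_le_one]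
    exact fun i => (norm_le_lpNorm a i).trans ha
  have hu : Summable fun k : ℕ => (1 / 2 : ℝ) ^ k :=
    summable_geometric_of_lt_one (by norm_num) (by norm_num)
  have hG (a) (ha : a ∈ S) (k : ℕ) : ‖G a k‖ ≤ (1 / 2) ^ k :=
    (norm_sum_smul_le_weakNorm (q := q) (p := p) (a k) (y k)).trans
      ((mul_le_of_le_one_left (weakNorm_nonneg (y k)) (ha k trivial)).trans (hy k))
  have hGs (a) (ha : a ∈ S) : Summable (G a) := hu.of_norm_bounded (hG a ha)
  have hcont : ContinuousOn (fun a => ∑' k, G a k) S :=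
    continuousOn_tsum (fun k => Continuous.continuousOn (by fun_prop)) hu fun k a ha => hG a ha k
  let K : CompactDisc 𝕜 Y :=
    { carrier := (fun a => ∑' k, G a k) '' S
      isCompact := hS.image_of_continuousOn hcont
      nonempty := by
        refine Set.Nonempty.image _ ⟨0, fun k _ => ?_⟩
        have := lpNorm_smul (p := q) (0 : 𝕜) (0 : Fin (M k) → 𝕜)
        rw [norm_zero, zero_mul] at this
        simp only [zero_smul] at this
        exact this.le.trans zero_le_one
      absConvex := by
        rintro _ ⟨a, ha, rfl⟩ _ ⟨b, hb, rfl⟩ s t hst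
        refine ⟨s • a + t • b, fun k _ => ?_, ?_⟩
        · calc lpNorm q (fun i => s • a k i + t • b k i)
              ≤ lpNorm q (fun i => s • a k i) + lpNorm q (fun i => t • b k i) := lpNorm_add_le _ _
            _ = ‖s‖ * lpNorm q (a k) + ‖t‖ * lpNorm q (b k) := by rw [lpNorm_smul, lpNorm_smul]
            _ ≤ ‖s‖ * 1 + ‖t‖ * 1 := by
                gcongr
                · exact ha k trivial
                · exact hb k trivial
            _ ≤ 1 := by simpa using hst
        · simp only
          rw [← (hGs a ha).tsum_const_smul s, ← (hGs b hb).tsum_const_smul t,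
            ← ((hGs a ha).const_smul s).tsum_add ((hGs b hb).const_smul t)]
          congr 1
          ext k
          simp [G, add_smul, mul_smul, Finset.sum_add_distrib, Finset.smul_sum] }
  have hK (k : ℕ) (a : Fin (M k) → 𝕜) (ha : lpNorm q a ≤ 1) : ∑ i, a i • y k i ∈ K.carrier := by
    refine ⟨Pi.single k a, fun l _ => ?_, ?_⟩
    · rcases eq_or_ne l k with rfl | h
      · simpa using ha
      · rw [Pi.single_eq_of_ne h]
        have := lpNorm_smul (p := q) (0 : 𝕜) (0 : Fin (M l) → 𝕜)
        rw [norm_zero, zero_mul] at this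
        simp only [zero_smul] at this
        exact this.le.trans zero_le_one
    · simp only
      rw [tsum_eq_single k fun l hl => ?_]
      · simp [G]
      · simp [G, Pi.single_eq_of_ne hl]
  have hyK (k : ℕ) (i : Fin (M k)) : y k i ∈ K.carrier := by
    have h1 : lpNorm q (Pi.single i 1 : Fin (M k) → 𝕜) ≤ 1 := by
      have := PiLp.norm_single q (fun _ : Fin (M k) => 𝕜) i 1
      rw [norm_one] at this
      exact this.le
    have := hK k _ h1
    simpa [Pi.single_apply, ite_smul] using this
  refine ⟨K, fun k => ⟨fun i => ⟨y k i, Submodule.subset_span (hyK k i)⟩, fun i => rfl, ?_⟩⟩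
  refine weakNorm_le_of_norm_sum_smul (q := q) fun a ha => ?_
  refine CompactDisc.norm_le_of_mem ⟨zero_le_one, _, hK k a ha, ?_⟩
  rw [map_sum]
  simp only [RCLike.ofReal_one, one_smul]
  rfl

end CompactSet

/-! ### The functionals defined by tensors -/

section Functionals

variable {p q : ℝ≥0∞} {𝕜 : Type*} [RCLike 𝕜] {X Y : Type*} [NormedAddCommGroup X]
  [NormedSpace 𝕜 X] [NormedAddCommGroup Y] [NormedSpace 𝕜 Y] [Fact (1 ≤ p)]

theorem trace_compTensor_coe [q.HolderConjugate p] (U : SummingOp 𝕜 p Y X)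
    (z : NuclearTensor 𝕜 q p (StrongDual 𝕜 X) Y) :
    trace 𝕜 X (compTensor U (toCompleted 𝕜 q p (StrongDual 𝕜 X) Y z)) = traceMap q U z := by
  obtain ⟨n, x, y, rfl⟩ := exists_rep z
  simp only [map_sum, compTensor_toCompleted, trace_toCompleted, traceMap_tmul]

/-- For each tensor, `U ↦ trace (U ∘ z)` is linear. -/
noncomputable def traceFunctional [q.HolderConjugate p]
    (z : CompletedTensor 𝕜 q p (StrongDual 𝕜 X) Y) : SummingOp 𝕜 p Y X →ₗ[𝕜] 𝕜 where
  toFun U := trace 𝕜 X (compTensor U z)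
  map_add' U V := by
    induction z using UniformSpace.Completion.induction_on with
    | hp => exact isClosed_eq (by fun_prop) (by fun_prop)
    | ih z =>
      have h (U : SummingOp 𝕜 p Y X) := trace_compTensor_coe (q := q) U z
      refine (h _).trans (.trans ?_ (congrArg₂ (· + ·) (h U) (h V)).symm)
      have := traceMap_sum_smul (q := q) Finset.univ ![(1 : 𝕜), 1] ![U, V] z
      simpa using this
  map_smul' c U := by
    induction z using UniformSpace.Completion.induction_on with
    | hp => exact isClosed_eq (by fun_prop) (by fun_prop)
    | ih z =>
      have h (U : SummingOp 𝕜 p Y X) := trace_compTensor_coe (q := q) U z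
      refine (h _).trans (.trans ?_ (congrArg (c * ·) (h U)).symm)
      have := traceMap_sum_smul (q := q) Finset.univ (fun _ : Fin 1 => c) (fun _ => U) z
      simpa using this

/-- The functional defined by a tensor is dominated by one of the seminorms that define `τ_p`: the
tensor is a series of finite tensors with geometrically decaying norms, and all of them come from
`Y_K` for a single compact set `K`. -/
theorem exists_bound_traceFunctional [CompleteSpace Y] [q.HolderConjugate p]
    (z : CompletedTensor 𝕜 q p (StrongDual 𝕜 X) Y) :
    ∃ (K : CompactDisc 𝕜 Y) (C : ℝ), 0 ≤ C ∧
      ∀ U, ‖traceFunctional z U‖ ≤ C * (SummingOp.precomp K.Phi U).piNorm := by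
  have := fact_left q p
  obtain ⟨w, hw, -, hwn⟩ := controlled_sum_of_mem_closure_range
    (j := (toCompleted 𝕜 q p (StrongDual 𝕜 X) Y).toLinearMap.toAddMonoidHom)
    (b := z) (UniformSpace.Completion.denseRange_coe z) (f := fun n => (1 / 4) ^ n)
    (fun n => by positivity)
  set C : ℝ := ‖w 0‖ + 1 with hC
  have hC1 : 1 ≤ C := by simp [hC]
  have hwC (k : ℕ) : ‖w k‖ < C * (1 / 2) ^ k * (1 / 2) ^ k := by
    rw [mul_assoc, ← mul_pow]
    norm_num
    rcases k.eq_zero_or_pos with rfl | hk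
    · simp [hC]
    · have h := hwn k hk
      have h' : ‖w k‖ < (1 / 4) ^ k := by
        rwa [show ‖w k‖ = _ from (UniformSpace.Completion.norm_coe _).symm]
      exact h'.trans_le (le_mul_of_one_le_left (by positivity) hC1)
  choose M x y hxy hx hy using fun k : ℕ => exists_rep_le (by positivity : 0 < C * (1 / 2) ^ k)
    (by positivity : (0 : ℝ) < (1 / 2) ^ k) (hwC k)
  obtain ⟨K, hK⟩ := exists_compactDisc (q := q) hy
  choose v hv hv1 using hK
  refine ⟨K, ∑' k : ℕ, C * (1 / 2) ^ k, tsum_nonneg fun k => by positivity, fun U => ?_⟩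
  have hU := (SummingOp.precomp K.Phi U).isSummingBound_piNorm
  have hlim := (((trace 𝕜 X).comp (compTensor U)).continuous.tendsto z).comp hw
  -- as `y k` lifts to `v k` in `Y_K`, only the values of `U Φ_K` matter
  have hterm (k : ℕ) : trace 𝕜 X (compTensor U (toCompleted 𝕜 q p (StrongDual 𝕜 X) Y (w k))) =
      ∑ i, x k i ((SummingOp.precomp K.Phi U).toCLM (v k i)) := by
    rw [trace_compTensor_coe, hxy, map_sum]
    refine Finset.sum_congr rfl fun i _ => ?_
    rw [traceMap_tmul, ← hv]
    rfl
  have hsum : Summable fun k : ℕ => C * (1 / 2 : ℝ) ^ k :=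
    (summable_geometric_of_lt_one (by norm_num) (by norm_num)).mul_left C
  refine le_of_tendsto hlim.norm (Filter.Eventually.of_forall fun n => ?_)
  have h1 : trace 𝕜 X (compTensor U (∑ k ∈ Finset.range (n + 1),
      toCompleted 𝕜 q p (StrongDual 𝕜 X) Y (w k))) = ∑ k ∈ Finset.range (n + 1),
      ∑ i, x k i ((SummingOp.precomp K.Phi U).toCLM (v k i)) := by
    rw [map_sum, map_sum]
    exact Finset.sum_congr rfl fun k _ => hterm k
  refine (congrArg norm h1).trans_le ?_
  calc ‖∑ k ∈ Finset.range (n + 1), ∑ i, x k i ((SummingOp.precomp K.Phi U).toCLM (v k i))‖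
      ≤ ∑ k ∈ Finset.range (n + 1), C * (1 / 2) ^ k * (SummingOp.precomp K.Phi U).piNorm := by
        refine norm_sum_le_of_le _ fun k _ => ?_
        refine (norm_sum_apply_comp_le (q := q) hU _ _).trans ?_
        refine mul_le_mul (hx k) ?_ (mul_nonneg hU.1 (weakNorm_nonneg _)) (by positivity)
        exact mul_le_of_le_one_right hU.1 (hv1 k)
    _ ≤ _ := by
        rw [← Finset.sum_mul]
        exact mul_le_mul_of_nonneg_right
          (hsum.sum_le_tsum _ fun k _ => by positivity) hU.1

theorem continuous_traceFunctional [CompleteSpace Y] [q.HolderConjugate p]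
    (z : CompletedTensor 𝕜 q p (StrongDual 𝕜 X) Y) : Continuous (traceFunctional z) := by
  obtain ⟨K, C, hC, hb⟩ := exists_bound_traceFunctional z
  refine withSeminorms_tau.continuous_normedSpace_rng _ _ ⟨{K}, ⟨C, hC⟩, fun U => ?_⟩
  rw [Finset.sup_singleton]
  exact hb U

/-- A continuous functional is dominated by one of the seminorms that define `τ_p`. -/
theorem exists_bound_of_continuous {R : Submodule 𝕜 (SummingOp 𝕜 p Y X)} (φ : R →L[𝕜] 𝕜) :
    ∃ (K : CompactDisc 𝕜 Y) (C : ℝ), 0 < C ∧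
      ∀ U : R, ‖φ U‖ ≤ C * (SummingOp.precomp K.Phi U.1).piNorm := by
  have h0 : (fun U : R => ‖φ U‖) ⁻¹' Set.Iio 1 ∈ 𝓝 (0 : R) := by
    refine φ.continuous.norm.continuousAt.preimage_mem_nhds ?_
    rw [map_zero, norm_zero]
    exact Iio_mem_nhds one_pos
  rw [nhds_subtype, Submodule.coe_zero] at h0
  obtain ⟨⟨K, ε⟩, hε, hK⟩ := (hasBasis_tau.comap _).mem_iff.1 h0
  replace hε : 0 < ε := hε
  refine ⟨K, ε⁻¹, inv_pos.2 hε, fun U => ?_⟩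
  refine le_of_forall_gt_imp_ge_of_dense fun b hb => ?_
  have hb' : (SummingOp.precomp K.Phi U.1).piNorm < ε * b := by rwa [inv_mul_lt_iff₀ hε] at hb
  have hb0 : 0 < b := by
    have := (SummingOp.piNorm_nonneg _).trans_lt hb'
    exact pos_of_mul_pos_right this hε.le
  have hmem : ((b⁻¹ : ℝ) : 𝕜) • U ∈ (fun U : R => ‖φ U‖) ⁻¹' Set.Iio 1 := by
    refine hK ?_
    change SummingOp.piSeminorm (SummingOp.precomp K.Phi (((b⁻¹ : ℝ) : 𝕜) • U.1)) < ε
    rw [map_smul, map_smul_eq_mul, RCLike.norm_ofReal, abs_of_pos (inv_pos.2 hb0),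
      inv_mul_lt_iff₀ hb0, mul_comm]
    exact hb'
  rw [Set.mem_preimage, Set.mem_Iio, map_smul, norm_smul, RCLike.norm_ofReal, abs_of_pos (inv_pos.2 hb0),
    inv_mul_lt_iff₀ hb0, mul_one] at hmem
  exact hmem.le

/-- Every continuous functional is given by a tensor with a representation by sequences. -/
theorem exists_tensor_of_continuous [q.HolderConjugate p]
    {R : Submodule 𝕜 (SummingOp 𝕜 p Y X)} (φ : R →L[𝕜] 𝕜) :
    ∃ z : CompletedTensor 𝕜 q p (StrongDual 𝕜 X) Y,
      (∃ (x' : ℕ → StrongDual 𝕜 X) (y : ℕ → Y), IsRepresentation z x' y) ∧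
      ∀ U : R, φ U = trace 𝕜 X (compTensor U.1 z) := by
  obtain ⟨K, C, hC, hφ⟩ := exists_bound_of_continuous φ
  obtain ⟨M, a, b, ha, hb, hlim⟩ := exists_series (q := q) (φ := φ.toLinearMap) hC hφ
    (ε := fun k => (1 / 4) ^ (k + 1)) (fun k => by positivity)
    ((tendsto_pow_atTop_nhds_zero_of_lt_one (by norm_num) (by norm_num)).comp
      (Filter.tendsto_add_atTop_nat 1))
  -- the decay of the weak norms is shared out between the two factors
  have h2 (k : ℕ) : ((2 : 𝕜) ^ k)⁻¹ * 2 ^ k = 1 := inv_mul_cancel₀ (pow_ne_zero k two_ne_zero)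
  obtain ⟨z, hz, hsum⟩ := exists_isRepresentation (𝕜 := 𝕜) (q := q) (p := p)
    (x := fun k A => ((2 : 𝕜) ^ k)⁻¹ • a k A) (y := fun k A => (2 : 𝕜) ^ k • b k A)
    (C := C + 1) (D := max 1 (weakNorm 𝕜 p (b 0)))
    (fun k => by
      have := fact_left q p
      rw [lpNorm_smul, norm_inv, norm_pow, RCLike.norm_ofNat, mul_comm, one_div, inv_pow]
      exact mul_le_mul_of_nonneg_right (ha k) (by positivity))
    (fun k => by
      refine (weakNorm_smul_le _ _).trans ?_
      rw [norm_pow, RCLike.norm_ofNat]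
      cases k with
      | zero => simp
      | succ k =>
        calc (2 : ℝ) ^ (k + 1) * weakNorm 𝕜 p (b (k + 1))
            ≤ 2 ^ (k + 1) * (1 / 4) ^ (k + 1) := by
              gcongr
              exact hb k
          _ = (1 / 2) ^ (k + 1) := by rw [← mul_pow]; norm_num
          _ ≤ _ := le_mul_of_one_le_left (by positivity) (le_max_left _ _))
  refine ⟨z, hz, fun U => ?_⟩
  have h1 := hsum.mapL ((trace 𝕜 X).comp (compTensor U.1))
  have h3 : HasSum (fun s : Σ k, Fin (M k) => a s.1 s.2 (U.1.toCLM (b s.1 s.2)))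
      (trace 𝕜 X (compTensor U.1 z)) := by
    refine h1.congr_fun fun s => ?_
    rw [ContinuousLinearMap.comp_apply, tmul_smul_smul, h2, one_smul, compTensor_toCompleted,
      trace_toCompleted]
  have h4 := (h3.sigma fun k => hasSum_fintype _).tendsto_sum_nat
  exact tendsto_nhds_unique (hlim U) (h4.comp (Filter.tendsto_add_atTop_nat 1))

/-- The map that takes a tensor `z` to the functional `U ↦ trace (U ∘ z)` on `R`. -/
noncomputable def dualMap [CompleteSpace Y] (q : ℝ≥0∞) [q.HolderConjugate p]
    (R : Submodule 𝕜 (SummingOp 𝕜 p Y X)) :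
    CompletedTensor 𝕜 q p (StrongDual 𝕜 X) Y →ₗ[𝕜] (R →L[𝕜] 𝕜) where
  toFun z := ⟨(traceFunctional z).domRestrict R,
    (continuous_traceFunctional z).comp continuous_subtype_val⟩
  map_add' z w := by
    ext U
    exact map_add ((trace 𝕜 X).comp (compTensor U.1)) z w
  map_smul' c z := by
    ext U
    exact map_smul ((trace 𝕜 X).comp (compTensor U.1)) c z

theorem dualMap_apply [CompleteSpace Y] [q.HolderConjugate p] {R : Submodule 𝕜 (SummingOp 𝕜 p Y X)}
    (z : CompletedTensor 𝕜 q p (StrongDual 𝕜 X) Y) (U : R) :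
    dualMap q R z U = trace 𝕜 X (compTensor U.1 z) := rfl

theorem isClosed_ker_dualMap [CompleteSpace Y] [q.HolderConjugate p]
    (R : Submodule 𝕜 (SummingOp 𝕜 p Y X)) :
    IsClosed ((dualMap q R).ker : Set (CompletedTensor 𝕜 q p (StrongDual 𝕜 X) Y)) := by
  have : ((dualMap q R).ker : Set (CompletedTensor 𝕜 q p (StrongDual 𝕜 X) Y)) =
      ⋂ U : R, {z | trace 𝕜 X (compTensor U.1 z) = 0} := by
    ext z
    simp [ContinuousLinearMap.ext_iff, dualMap_apply]
  rw [this]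
  exact isClosed_iInter fun U => isClosed_eq (by fun_prop) continuous_const

end Functionals

end PSumming

theorem proposition1 {𝕜 : Type*} [RCLike 𝕜]
    {X Y : Type*} [NormedAddCommGroup X] [NormedSpace 𝕜 X] [CompleteSpace X]
    [NormedAddCommGroup Y] [NormedSpace 𝕜 Y] [CompleteSpace Y]
    (p p' : ℝ≥0∞) [Fact (1 ≤ p)] [p'.HolderConjugate p]
    (R : Submodule 𝕜 (PSumming.SummingOp 𝕜 p Y X))
    (hR : ∀ (f : StrongDual 𝕜 Y) (x : X), PSumming.SummingOp.rankOne f x ∈ R) :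
    (∀ φ : R →L[𝕜] 𝕜, ∃ z : PSumming.CompletedTensor 𝕜 p' p (StrongDual 𝕜 X) Y,
      (∃ (x' : ℕ → StrongDual 𝕜 X) (y : ℕ → Y), PSumming.IsRepresentation z x' y) ∧
      ∀ U : R, φ U = PSumming.trace 𝕜 X (PSumming.compTensor U.1 z)) ∧
    (∀ z : PSumming.CompletedTensor 𝕜 p' p (StrongDual 𝕜 X) Y, ∃ φ : R →L[𝕜] 𝕜,
      ∀ U : R, φ U = PSumming.trace 𝕜 X (PSumming.compTensor U.1 z)) ∧
    (∃ N : Submodule 𝕜 (PSumming.CompletedTensor 𝕜 p' p (StrongDual 𝕜 X) Y),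
      IsClosed (N : Set (PSumming.CompletedTensor 𝕜 p' p (StrongDual 𝕜 X) Y)) ∧
      ∃ e : (PSumming.CompletedTensor 𝕜 p' p (StrongDual 𝕜 X) Y ⧸ N) ≃ₗ[𝕜] (R →L[𝕜] 𝕜),
        ∀ (z : PSumming.CompletedTensor 𝕜 p' p (StrongDual 𝕜 X) Y) (U : R),
          e (N.mkQ z) U = PSumming.trace 𝕜 X (PSumming.compTensor U.1 z)) := by
  have hsurj : Function.Surjective (PSumming.dualMap p' R) := fun φ => by
    obtain ⟨z, -, hz⟩ := PSumming.exists_tensor_of_continuous (q := p') φ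
    exact ⟨z, ContinuousLinearMap.ext fun U => (hz U).symm⟩
  refine ⟨PSumming.exists_tensor_of_continuous, fun z => ⟨PSumming.dualMap p' R z, fun U => rfl⟩,
    (PSumming.dualMap p' R).ker, PSumming.isClosed_ker_dualMap R,
    (PSumming.dualMap p' R).quotKerEquivOfSurjective hsurj, fun z U => rfl⟩
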